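/- A plane map is an embedding of a finite connected multigraph in the sphere; a triangulation is a plane map in which every face has size 3. A \emph{lopsp-operation} is a plane triangulation $O$ together with a colouring $c: V_O \to \{0,1,2\}$ such that no edge joins two vertices of the same colour, and three distinct marked vertices $v_0, v_1, v_2$ such that $c(v_0), c(v_2) \neq 1$; if $c(v_1) = 1$ then $\deg(v_1) = 2$; and every vertex $v \notin \{v_0, v_1, v_2\}$ with $c(v) = 1$ has $\deg(v) = 4$. An edge has colour $i$ if it is not incident with a vertex of colour $i$. The \emph{predecoration} $Q(O)$ is the submap of $O$ consisting of all vertices of colours $0$ and $2$ and all edges of colour $1$, together with, if $c(v_1) = 1$, the vertex $v_1$ and the edge of colour $2$ incident with $v_1$. A \emph{cut-path} of $O$ is a path $P$ (without repeated vertices) in $O$ from $v_1$ to $v_2$ that passes through $v_0$. Cutting $O$ along $P$ gives the map $O_P$, in which the faces of $O$ are kept and there is one new face, whose boundary consists of two copies of $P$. A 2-cycle is a cycle with two distinct vertices and two distinct parallel edges. The operation $O$ is \textbf{c2} if for every cut-path $P$ of minimal length (among all cut-paths of $O$) there is no 2-cycle in $O_P$. \textbf{Theorem.} A lopsp-operation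 $O$ is \textbf{c2} if and only if for every 2-cycle $C$ in $Q(O)$, each of the two sides of $C$ (the two connected components of the sphere minus $C$) contains at least one of $v_0$, $v_1$, $v_2$ (which is then not a vertex of $C$). -/

import Mathlib

/-- A combinatorial map on a set `D` of directed edges: `σ d` is the directed edge following `d`
in the cyclic order around the starting vertex of `d`, and `θ d` is the inverse of `d`.  As every
vertex of a map with at least one edge has a directed edge starting in it, vertices are the orbits
of `σ`. -/
structure CombMap (D : Type*) where
  σ : Equiv.Perm D
  θ : Equiv.Perm D
  θ_θ : ∀ d, θ (θ d) = d
  θ_ne : ∀ d, θ d ≠ d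

namespace CombMap

variable {D : Type*} (M : CombMap D)

/-- The vertices of a map. -/
abbrev Vertex : Type _ := Quotient (Equiv.Perm.SameCycle.setoid M.σ)

/-- The (undirected) edges of a map. -/
abbrev Edge : Type _ := Quotient (Equiv.Perm.SameCycle.setoid M.θ)

/-- The faces of a map: the orbits of `θσ`. -/
abbrev Face : Type _ := Quotient (Equiv.Perm.SameCycle.setoid (M.θ * M.σ))

/-- The starting vertex of a directed edge. -/
def src (d : D) : M.Vertex := Quotient.mk _ d

/-- The end vertex of a directed edge. -/
def tgt (d : D) : M.Vertex := M.src (M.θ d)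

/-- The face of a directed edge `d`, which is the face that has its corner at the starting vertex
of `d` between `d` and `σ d`. -/
def face (d : D) : M.Face := Quotient.mk _ d

/-- The degree of a vertex (a loop would count twice). -/
noncomputable def degree (u : M.Vertex) : ℕ := Nat.card {d : D // M.src d = u}

/-- The size of a face: the number of directed edges in it. -/
noncomputable def faceSize (f : M.Face) : ℕ := Nat.card {d : D // M.face d = f}

/-- The adjacency graph of a map, forgetting loops and the multiplicity of edges. -/
def graph : SimpleGraph M.Vertex :=
  SimpleGraph.fromRel fun u w => ∃ d, M.src d = u ∧ M.tgt d = w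

/-- The genus of a (connected) map. -/
noncomputable def genus : ℚ :=
  (2 - (Nat.card M.Vertex : ℚ) + Nat.card M.Edge - Nat.card M.Face) / 2

/-- A map is plane if it is (connected and) of genus `0`. -/
def IsPlane : Prop := M.graph.Connected ∧ M.genus = 0

/-- Every face has size `3`. -/
def IsTriangulation : Prop := ∀ f : M.Face, M.faceSize f = 3

/-- A submap, given by its vertices and its directed edges; its embedding is the one induced by
that of `M`. -/
structure Submap where
  verts : Set M.Vertex
  darts : Set D
  θ_mem : ∀ d ∈ darts, M.θ d ∈ darts
  src_mem : ∀ d ∈ darts, M.src d ∈ verts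

/-- `a` and `b` are the two edges, both directed from the vertex `x` to the vertex `y ≠ x`, of a
cycle of length 2 with vertices `x` and `y`. -/
structure IsTwoCycle (a b : D) : Prop where
  src_eq : M.src a = M.src b
  tgt_eq : M.tgt a = M.tgt b
  not_loop : M.src a ≠ M.tgt a
  ne : a ≠ b

/-- The submap consisting of the vertices and edges of the 2-cycle with edges `a` and `b`. -/
def twoCycle {M : CombMap D} {a b : D} (h : M.IsTwoCycle a b) : M.Submap where
  verts := {M.src a, M.tgt a}
  darts := {a, M.θ a, b, M.θ b}
  θ_mem := by
    rintro d (rfl | rfl | rfl | rfl) <;> simp [M.θ_θ]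
  src_mem := by
    rintro d (rfl | rfl | rfl | rfl)
    · exact Or.inl rfl
    · exact Or.inr rfl
    · exact Or.inl h.src_eq.symm
    · exact Or.inr h.tgt_eq.symm

namespace Submap

variable {M} (H : M.Submap)

/-- A 2-cycle in a submap. -/
structure IsTwoCycle (a b : D) : Prop extends M.IsTwoCycle a b where
  fst_mem : a ∈ H.darts
  snd_mem : b ∈ H.darts

/-- Two faces of `M` that share an edge that is not in `H`. -/
def FaceAdj (f g : M.Face) : Prop :=
  ∃ d, d ∉ H.darts ∧ M.face d = f ∧ M.face (M.θ d) = g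

/-- The connected components of the surface after removal of `H`.  Each of them is described by
the faces of `M` contained in it: two faces of `M` are in the same component if one can go from
one to the other while crossing only edges that are not in `H`.  For a cycle `H` in a plane map
these are the two sides of the cycle. -/
abbrev Side : Type _ := Quotient (Relation.EqvGen.setoid H.FaceAdj)

/-- The component in which a face of `M` is contained. -/
def side (f : M.Face) : H.Side := Quotient.mk _ f

/-- The vertices in the interior of a component: the vertices that are not in `H` and that are
incident with a face contained in that component. -/
def interiorVerts (S : H.Side) : Set M.Vertex :=
  {u | u ∉ H.verts ∧ ∃ d, M.src d = u ∧ H.side (M.face d) = S}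

end Submap

/-- `M.IsWalk u P w`: the directed edges in `P` form a walk from `u` to `w`. -/
def IsWalk : M.Vertex → List D → M.Vertex → Prop
  | u, [], w => u = w
  | u, d :: P, w => M.src d = u ∧ IsWalk (M.tgt d) P w

/-- The vertices of a walk with directed edges `P` that starts in `u`. -/
def walkVerts (u : M.Vertex) (P : List D) : List M.Vertex := u :: P.map M.tgt

/-- A path: a walk without repeated vertices. -/
def IsPath (u : M.Vertex) (P : List D) (w : M.Vertex) : Prop :=
  M.IsWalk u P w ∧ (M.walkVerts u P).Nodup

/-- For `P = [p₁, …, pₙ]` this is `[pₙ, …, p₁, θ p₁, …, θ pₙ]`, the closed walk that goes along `P`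
in one direction and back along `P` in the other direction. -/
def boundaryWalk (P : List D) : List D := P.reverse ++ P.map M.θ

theorem θ_mem_boundaryWalk {P : List D} {d : D} (h : d ∈ M.boundaryWalk P) :
    M.θ d ∈ M.boundaryWalk P := by
  simp only [boundaryWalk, List.mem_append, List.mem_reverse, List.mem_map] at h ⊢
  rcases h with h | ⟨e, he, rfl⟩
  · exact Or.inr ⟨d, h, rfl⟩
  · exact Or.inl (by rwa [M.θ_θ])

/-- The directed edges of `M` cut along `P`: each directed edge `d` of an edge of `P` has two copies,
`inl d` and `inr d`; the first one is in the same face as `d` in `M`, and the second one is in the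
new outer face. -/
abbrev CutDart (P : List D) : Type _ := D ⊕ {d // d ∈ M.boundaryWalk P}

open Classical in
/-- The inverse of a directed edge in `M` cut along `P`: for every edge of `P`, one of the two
copies of that edge consists of `inl d` and `inr (θ d)`, and the other one of `inr d` and
`inl (θ d)`. -/
noncomputable def cutInv (P : List D) : M.CutDart P → M.CutDart P
  | .inl d => if h : d ∈ M.boundaryWalk P then .inr ⟨M.θ d, M.θ_mem_boundaryWalk h⟩
      else .inl (M.θ d)
  | .inr d => .inl (M.θ d)

theorem cutInv_cutInv (P : List D) (d : M.CutDart P) : M.cutInv P (M.cutInv P d) = d := by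
  rcases d with d | ⟨d, hd⟩
  · by_cases h : d ∈ M.boundaryWalk P
    · simp [cutInv, h, M.θ_θ]
    · have h2 : M.θ d ∉ M.boundaryWalk P := fun h2 => h (by
        have := M.θ_mem_boundaryWalk h2
        rwa [M.θ_θ] at this)
      simp [cutInv, h, h2, M.θ_θ]
  · simp [cutInv, M.θ_mem_boundaryWalk hd, M.θ_θ]

theorem cutInv_ne (P : List D) (d : M.CutDart P) : M.cutInv P d ≠ d := by
  rcases d with d | ⟨d, hd⟩
  · by_cases h : d ∈ M.boundaryWalk P
    · simp [cutInv, h]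
    · simp [cutInv, h, M.θ_ne]
  · simp [cutInv]

open Classical in
/-- The face permutation of `M` cut along `P`: the faces of `M` are kept, and there is one new face,
the outer face, whose boundary consists of two copies of `P`. -/
noncomputable def cutFace (P : List D) : Equiv.Perm (M.CutDart P) :=
  Equiv.sumCongr (M.θ * M.σ) (M.boundaryWalk P).attach.formPerm

/-- The map `M_P` that is obtained by cutting `M` along the path `P`: the map with the directed
edges, the inverses and the faces described above.  As the face permutation has to be `θσ`, this
determines `σ`. -/
noncomputable def cut (P : List D) : CombMap (M.CutDart P) where
  θ := Function.Involutive.toPerm (M.cutInv P) (M.cutInv_cutInv P)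
  σ := Function.Involutive.toPerm (M.cutInv P) (M.cutInv_cutInv P) * M.cutFace P
  θ_θ := M.cutInv_cutInv P
  θ_ne := M.cutInv_ne P

theorem cut_face_perm (P : List D) : (M.cut P).θ * (M.cut P).σ = M.cutFace P :=
  Equiv.ext fun d => M.cutInv_cutInv P (M.cutFace P d)

end CombMap

/-- A local orientation-preserving symmetry-preserving operation: a 3-coloured plane triangulation
with three special vertices `v 0`, `v 1` and `v 2`. -/
structure LopspOperation (D : Type*) extends CombMap D where
  colour : toCombMap.Vertex → Fin 3
  v : Fin 3 → toCombMap.Vertex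
  v_injective : Function.Injective v
  isPlane : toCombMap.IsPlane
  isTriangulation : toCombMap.IsTriangulation
  proper : ∀ d, colour (toCombMap.src d) ≠ colour (toCombMap.tgt d)
  colour_v0 : colour (v 0) ≠ 1
  colour_v2 : colour (v 2) ≠ 1
  degree_v1 : colour (v 1) = 1 → toCombMap.degree (v 1) = 2
  degree_of_colour_one : ∀ u, (∀ i, u ≠ v i) → colour u = 1 → toCombMap.degree u = 4

namespace LopspOperation

variable {D : Type*} (O : LopspOperation D)

/-- An edge has colour `i` if it is not incident with a vertex of colour `i`. -/
def EdgeColour (d : D) (i : Fin 3) : Prop :=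
  O.colour (O.src d) ≠ i ∧ O.colour (O.tgt d) ≠ i

/-- The predecoration `Q(O)`: all vertices of colours 0 and 2 and all edges of colour 1 and, if the
colour of `v 1` is 1, also `v 1` and the edge of colour 2 incident with `v 1`. -/
def predecoration : O.toCombMap.Submap where
  verts := {u | O.colour u = 0 ∨ O.colour u = 2 ∨ (O.colour (O.v 1) = 1 ∧ u = O.v 1)}
  darts := {d | O.EdgeColour d 1 ∨
    (O.colour (O.v 1) = 1 ∧ O.EdgeColour d 2 ∧ (O.src d = O.v 1 ∨ O.tgt d = O.v 1))}
  θ_mem := by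
    have key : ∀ d i, O.EdgeColour d i → O.EdgeColour (O.θ d) i := fun d i h =>
      ⟨h.2, by simpa only [CombMap.tgt, O.θ_θ] using h.1⟩
    rintro d (h | ⟨h1, h2, h3⟩)
    · exact Or.inl (key _ _ h)
    · refine Or.inr ⟨h1, key _ _ h2, h3.symm.imp id fun h => ?_⟩
      simpa only [CombMap.tgt, O.θ_θ] using h
  src_mem := by
    have cases3 : ∀ i : Fin 3, i = 0 ∨ i = 1 ∨ i = 2 := by decide
    rintro d (h | ⟨h1, h2, h3⟩)
    · rcases cases3 (O.colour (O.src d)) with h0 | h0 | h0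
      · exact Or.inl h0
      · exact absurd h0 h.1
      · exact Or.inr (Or.inl h0)
    · rcases cases3 (O.colour (O.src d)) with h0 | h0 | h0
      · exact Or.inl h0
      · rcases h3 with h3 | h3
        · exact Or.inr (Or.inr ⟨h1, h3⟩)
        · exact absurd (h0.trans (h3 ▸ h1).symm) (O.proper d)
      · exact absurd h0 h2.1

/-- A cut-path: a path from `v 1` to `v 2` that passes through `v 0`. -/
def IsCutPath (P : List D) : Prop :=
  O.IsPath (O.v 1) P (O.v 2) ∧ O.v 0 ∈ O.walkVerts (O.v 1) P

/-- A cut-path of minimal length. -/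
def IsMinCutPath (P : List D) : Prop :=
  O.IsCutPath P ∧ ∀ P', O.IsCutPath P' → P.length ≤ P'.length

/-- A lopsp-operation `O` is `c2` if for every cut-path `P` of minimal length, there is no 2-cycle
in `O_P`. -/
def IsC2 : Prop := ∀ P, O.IsMinCutPath P → ¬ ∃ a b, (O.cut P).IsTwoCycle a b

end LopspOperation

/-! Both conditions say that there is no free region: a set of faces bounded by a 2-cycle of `O`
whose interior contains no special vertex. A free region is recorded by its directed edges, with the
names of the two cycle edges chosen so that the region has `a` and `θ b` but neither `θ a` nor `b`.

Suppose that there is a free region. An excursion of a cut-path into its interior starts and ends at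
the two cycle vertices and meets no special vertex strictly between them, so one edge of the cycle
can replace it. Hence some minimal cut-path avoids the interior (`exists_isMinCutPath_avoiding`).
Cutting along it leaves the region intact, so its boundary is a 2-cycle of `O_P`
(`exists_isTwoCycle_cut`).

Conversely, project a 2-cycle of `O_P` to `O`. Two copies of the same edge would force `P` to have
only that edge, but `P` has three special vertices; so the projection is a 2-cycle. The outer face
lies on one side of the lifted cycle and has a corner at every vertex of `P`, so the other side has
no path vertex in its interior and is free. The Jordan-type statement here is homological: Euler's
formula gives a mod 2 function on the faces of `O` that changes exactly across the cycle
(`exists_potential`), and it extends consistently to the outer face (`IsPath.outer_potential_eq`).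

It remains to pass from 2-cycles of `O` to those of `Q(O)`. A vertex of colour 1 on the boundary of
a free region has degree 4, with the two cycle edges opposite. Removing the two inner triangles
there, or adding the two outer ones if nothing else is inside, yields a free region without colour 1
on its boundary (`exists_isFreeRegion_colour_ne_one`). -/

namespace CombMap

/-! ### Orbits of the permutations, and connectedness -/

section Basic

variable {D : Type*} (M : CombMap D)

/-- The face permutation. -/
abbrev φ : Equiv.Perm D := M.θ * M.σ

theorem φ_apply (d : D) : M.φ d = M.θ (M.σ d) := rfl

theorem θ_φ (d : D) : M.θ (M.φ d) = M.σ d := M.θ_θ _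

theorem θ_eq_iff {d e : D} : M.θ d = e ↔ d = M.θ e :=
  ⟨fun h => by rw [← h, M.θ_θ], fun h => by rw [h, M.θ_θ]⟩

theorem src_σ (d : D) : M.src (M.σ d) = M.src d :=
  Quotient.sound (Equiv.Perm.sameCycle_apply_left.2 (Equiv.Perm.SameCycle.refl _ _))

theorem src_eq_src_iff {d e : D} : M.src d = M.src e ↔ M.σ.SameCycle d e := Quotient.eq

theorem exists_src_eq (u : M.Vertex) : ∃ d, M.src d = u := Quotient.exists_rep u

theorem src_θ (d : D) : M.src (M.θ d) = M.tgt d := rfl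

theorem tgt_θ (d : D) : M.tgt (M.θ d) = M.src d := by rw [tgt, M.θ_θ]

theorem tgt_φ (d : D) : M.tgt (M.φ d) = M.src d := by
  rw [φ_apply, tgt_θ, src_σ]

theorem src_φ (d : D) : M.src (M.φ d) = M.tgt (M.σ d) := rfl

theorem face_φ (d : D) : M.face (M.φ d) = M.face d :=
  Quotient.sound (Equiv.Perm.sameCycle_apply_left.2 (Equiv.Perm.SameCycle.refl _ _))

theorem face_eq_face_iff {d e : D} : M.face d = M.face e ↔ M.φ.SameCycle d e := Quotient.eq

/-- The edge of a directed edge. -/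
def edge (d : D) : M.Edge := Quotient.mk _ d

theorem edge_eq_edge_iff {d e : D} : M.edge d = M.edge e ↔ d = e ∨ d = M.θ e := by
  have h1 : M.edge d = M.edge e ↔ M.θ.SameCycle d e := Quotient.eq
  have h2 : M.θ ^ 2 = 1 := Equiv.ext fun d => by simp [pow_two, M.θ_θ]
  rw [h1]
  constructor
  · rintro ⟨i, hi⟩
    rcases Int.even_or_odd' i with ⟨k, rfl | rfl⟩
    · rw [zpow_mul, zpow_ofNat, h2, one_zpow] at hi
      exact Or.inl hi
    · rw [zpow_add, zpow_mul, zpow_ofNat, h2, one_zpow, one_mul, zpow_one] at hi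
      exact Or.inr (M.θ_eq_iff.1 hi)
  · rintro (rfl | rfl)
    · exact .refl _ _
    · exact Equiv.Perm.sameCycle_apply_left.2 (.refl _ _)

variable {M}

/-- A set of directed edges that is a union of orbits of a permutation. -/
theorem _root_.Equiv.Perm.SameCycle.mem_iff {α : Type*} {f : Equiv.Perm α} {T : Set α}
    (hT : ∀ d, f d ∈ T ↔ d ∈ T) {d e : α} (h : f.SameCycle d e) : d ∈ T ↔ e ∈ T := by
  have key : ∀ (n : ℕ) d, (f ^ n) d ∈ T ↔ d ∈ T := by
    intro n
    induction n with
    | zero => simp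
    | succ n ih => intro d; rw [pow_succ', Equiv.Perm.mul_apply, hT, ih]
  obtain ⟨i, rfl⟩ := h
  obtain ⟨n, rfl | rfl⟩ := i.eq_nat_or_neg
  · rw [zpow_natCast, key]
  · rw [← key n ((f ^ (-(n : ℤ))) d)]
    simp

theorem _root_.Equiv.Perm.SameCycle.apply_eq_apply {α β : Type*} {f : Equiv.Perm α} {g : α → β}
    (hg : ∀ d, g (f d) = g d) {d e : α} (h : f.SameCycle d e) : g d = g e :=
  ((h.mem_iff (T := {x | g x = g e}) fun d => by simp [hg])).2 rfl

/-- Invariance under `φ` and `θ` gives invariance under `σ`, so `T` contains all or none of the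
directed edges at a vertex, and `θ` carries it along the walks of the graph. -/
theorem eq_univ_of_connected (hM : M.graph.Connected) {T : Set D}
    (hφ : ∀ d, M.φ d ∈ T ↔ d ∈ T) (hθ : ∀ d ∈ T, M.θ d ∈ T) (hne : T.Nonempty) (d : D) :
    d ∈ T := by
  have hθ' : ∀ d, M.θ d ∈ T ↔ d ∈ T := fun d => ⟨fun h => M.θ_θ d ▸ hθ _ h, hθ d⟩
  have hσ : ∀ d, M.σ d ∈ T ↔ d ∈ T := fun d => by rw [← hφ d, ← hθ', φ_apply]
  obtain ⟨e, he⟩ := hne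
  have step : ∀ u w : M.Vertex, M.graph.Adj u w → (∃ d ∈ T, M.src d = u) →
      ∃ d ∈ T, M.src d = w := by
    rintro u w ⟨-, ⟨d, hu, hw⟩ | ⟨d, hw, hu⟩⟩ ⟨e, he, hs⟩
    · exact ⟨M.θ d, hθ _ (((M.src_eq_src_iff.1 (hs.trans hu.symm)).mem_iff hσ).1 he), hw⟩
    · refine ⟨d, ?_, hw⟩
      rw [← hθ']
      exact ((M.src_eq_src_iff.1 (hs.trans hu.symm)).mem_iff hσ).1 he
  obtain ⟨p⟩ := hM.preconnected (M.src e) (M.src d)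
  have key : ∀ u w : M.Vertex, M.graph.Walk u w → (∃ d ∈ T, M.src d = u) →
      ∃ d ∈ T, M.src d = w := by
    intro u w p
    induction p with
    | nil => exact id
    | cons h _ ih => exact fun hu => ih (step _ _ h hu)
  obtain ⟨e', he', hs⟩ := key _ _ p ⟨e, he, rfl⟩
  exact ((M.src_eq_src_iff.1 hs).mem_iff hσ).1 he'

theorem apply_eq_apply_of_connected (hM : M.graph.Connected) {α : Type*} {f : D → α}
    (hφ : ∀ d, f (M.φ d) = f d) (hθ : ∀ d, f (M.θ d) = f d) (d e : D) : f d = f e :=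
  eq_univ_of_connected hM (T := {d | f d = f e}) (fun d => by
    rw [Set.mem_ofPred_eq, hφ, Set.mem_ofPred_eq])
    (fun d hd => (hθ d).trans hd) ⟨e, rfl⟩ d

-- Rotation permutes the directed edges at a vertex. Combined with `φ = θσ`, this drives all the
-- counting arguments around a vertex.
variable (M) in
theorem sum_σ {A : Type*} [AddCommMonoid A] [Fintype D] [DecidableEq M.Vertex] (f : D → A)
    (u : M.Vertex) : ∑ d with M.src d = u, f (M.σ d) = ∑ d with M.src d = u, f d :=
  Finset.sum_equiv M.σ (fun d => by simp [src_σ]) fun _ _ => rfl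

end Basic

/-! ### Mod 2 homology of plane maps -/

section Homology

open Matrix

variable {D : Type*} [Fintype D]

open Classical in
/-- The matrix with the number of elements in each of the intersections of fibres of two maps. -/
noncomputable def incidenceMatrix {I J : Type*} (p : D → I) (q : D → J) :
    Matrix I J (ZMod 2) :=
  .of fun i j => ∑ d with p d = i ∧ q d = j, 1

theorem incidenceMatrix_transpose {I J : Type*} (p : D → I) (q : D → J) :
    (incidenceMatrix p q)ᵀ = incidenceMatrix q p := by
  ext i j
  simp only [incidenceMatrix, transpose_apply, of_apply]
  exact Finset.sum_congr (by ext; simp [and_comm]) fun _ _ => rfl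

theorem incidenceMatrix_mulVec {I J : Type*} [Fintype J] [DecidableEq I] (p : D → I) (q : D → J)
    (f : J → ZMod 2) (i : I) :
    (incidenceMatrix p q *ᵥ f) i = ∑ d with p d = i, f (q d) := by
  classical
  simp only [incidenceMatrix, mulVec, dotProduct, of_apply, Finset.sum_mul, one_mul]
  rw [← Finset.sum_fiberwise (s := Finset.univ.filter fun d => p d = i) (g := q)]
  refine Finset.sum_congr rfl fun j _ => ?_
  rw [Finset.filter_filter]
  refine Finset.sum_congr (by congr!) fun d hd => ?_
  rw [(Finset.mem_filter.1 hd).2.2]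

variable {M : CombMap D}

theorem sum_edge {A : Type*} [AddCommMonoid A] [DecidableEq M.Edge] (f : D → A) (d : D) :
    ∑ e with M.edge e = M.edge d, f e = f d + f (M.θ d) := by
  classical
  rw [← Finset.sum_pair (M.θ_ne d).symm]
  refine Finset.sum_congr ?_ fun _ _ => rfl
  ext e
  simp [edge_eq_edge_iff]

/-- The row of an edge adds the values at its two ends (or two sides), so modulo 2 the kernel
consists of the functions that agree across every edge. By `h` these are the constants. -/
theorem finrank_ker_incidenceMatrix {J : Type*} [Fintype J] [Nonempty D] {q : D → J}
    (hq : Function.Surjective q)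
    (h : ∀ f : J → ZMod 2, (∀ d, f (q d) = f (q (M.θ d))) → ∀ d e, f (q d) = f (q e)) :
    Module.finrank (ZMod 2) (incidenceMatrix M.edge q).mulVecLin.ker = 1 := by
  classical
  have : Nonempty J := Nonempty.map q inferInstance
  have : (incidenceMatrix M.edge q).mulVecLin.ker = Submodule.span (ZMod 2) {fun _ => 1} := by
    ext f
    rw [LinearMap.mem_ker, Submodule.mem_span_singleton, mulVecLin_apply]
    constructor
    · intro hf
      have h1 := h f fun d => by
        have := congrFun hf (M.edge d)
        rw [incidenceMatrix_mulVec, sum_edge] at this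
        exact CharTwo.add_eq_zero.1 this
      obtain ⟨d⟩ := ‹Nonempty D›
      refine ⟨f (q d), funext fun j => ?_⟩
      obtain ⟨e, rfl⟩ := hq j
      simpa using h1 d e
    · rintro ⟨c, rfl⟩
      funext e
      obtain ⟨d, rfl⟩ : ∃ d, M.edge d = e := Quotient.exists_rep e
      rw [incidenceMatrix_mulVec, sum_edge]
      exact CharTwo.add_self_eq_zero _
  rw [this]
  exact finrank_span_singleton fun h => one_ne_zero (congrFun h (Classical.arbitrary J))

/-- The first homology group modulo 2 of a plane map is trivial. -/
theorem exists_potential [DecidableEq M.Vertex] (hM : M.IsPlane) {c : D → ZMod 2}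
    (hθ : ∀ d, c (M.θ d) = c d)
    (hc : ∀ u, ∑ d with M.src d = u, c d = 0) :
    ∃ g : D → ZMod 2, (∀ d, g (M.φ d) = g d) ∧ ∀ d, g (M.θ d) = g d + c d := by
  classical
  obtain ⟨hconn, hgenus⟩ := hM
  have : Nonempty D := by
    obtain ⟨u⟩ := hconn.nonempty
    exact ⟨(M.exists_src_eq u).choose⟩
  set A := incidenceMatrix M.edge M.face
  set B := incidenceMatrix M.src M.edge
  have hB : Bᵀ = incidenceMatrix M.edge M.src := incidenceMatrix_transpose _ _
  -- This is `∂∂ = 0`: at a vertex, each face corner contributes to the two edges beside it.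
  have hle : A.mulVecLin.range ≤ B.mulVecLin.ker := by
    rintro _ ⟨g, rfl⟩
    rw [LinearMap.mem_ker, mulVecLin_apply, mulVecLin_apply]
    funext u
    simp only [A, B, incidenceMatrix_mulVec, sum_edge]
    rw [Finset.sum_add_distrib, ← M.sum_σ (fun d => g (M.face (M.θ d)))]
    simp only [← φ_apply, face_φ]
    exact CharTwo.add_self_eq_zero _
  have h1 : Module.finrank (ZMod 2) A.mulVecLin.ker = 1 :=
    finrank_ker_incidenceMatrix Quotient.mk_surjective fun f hf =>
      apply_eq_apply_of_connected hconn (f := f ∘ M.face)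
        (fun d => congrArg f (M.face_φ d)) fun d => (hf d).symm
  have h2 : Module.finrank (ZMod 2) Bᵀ.mulVecLin.ker = 1 := by
    rw [hB]
    refine finrank_ker_incidenceMatrix Quotient.mk_surjective fun f hf =>
      apply_eq_apply_of_connected hconn (f := f ∘ M.src) (fun d => ?_) fun d => (hf d).symm
    exact ((hf (M.σ d)).symm).trans (congrArg f (M.src_σ d))
  have r1 := A.mulVecLin.finrank_range_add_finrank_ker
  have r2 := Bᵀ.mulVecLin.finrank_range_add_finrank_ker
  have r3 := B.mulVecLin.finrank_range_add_finrank_ker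
  have r4 : Module.finrank (ZMod 2) Bᵀ.mulVecLin.range =
      Module.finrank (ZMod 2) B.mulVecLin.range :=
    B.rank_transpose
  rw [Module.finrank_fintype_fun_eq_card] at r1 r2 r3
  have hEuler : Fintype.card M.Vertex + Fintype.card M.Face = Fintype.card M.Edge + 2 := by
    simp only [genus, Nat.card_eq_fintype_card] at hgenus
    have : (Fintype.card M.Vertex + Fintype.card M.Face : ℚ) = Fintype.card M.Edge + 2 := by
      linarith
    exact_mod_cast this
  -- The rank of `A` is `F - 1`, that of `B` is `V - 1`, and Euler's formula makes `E - (V - 1)`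
  -- equal to `F - 1`.
  have heq := Submodule.eq_of_le_of_finrank_eq hle (by omega)
  let f : M.Edge → ZMod 2 := Quotient.lift c fun d e h => by
    have : M.edge d = M.edge e := Quotient.sound h
    rcases M.edge_eq_edge_iff.1 this with rfl | rfl
    · rfl
    · exact hθ _
  have hf : f ∈ B.mulVecLin.ker := by
    rw [LinearMap.mem_ker, mulVecLin_apply]
    funext u
    simp only [B, incidenceMatrix_mulVec]
    exact hc u
  rw [← heq] at hf
  obtain ⟨g, hg⟩ := hf
  refine ⟨fun d => g (M.face d), fun d => congrArg g (M.face_φ d), fun d => ?_⟩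
  have := congrFun hg (M.edge d)
  simp only [A, mulVecLin_apply, incidenceMatrix_mulVec, sum_edge] at this
  have h3 : c d = g (M.face d) + g (M.face (M.θ d)) := this.symm
  rw [h3, ← add_assoc, CharTwo.add_self_eq_zero, zero_add]

end Homology

end CombMap

namespace CombMap

/-! ### Regions bounded by a 2-cycle -/

section Region

variable {D : Type*} (M : CombMap D)

/-- A union of faces, given by its directed edges, whose boundary edges are in `C`. -/
structure IsRegion (C T : Set D) : Prop where
  φ_mem_iff : ∀ d, M.φ d ∈ T ↔ d ∈ T
  θ_mem : ∀ d ∈ T, d ∉ C → M.θ d ∈ T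

/-- The directed edges of the edges of `a` and `b`. -/
def edgePair (a b : D) : Set D := {a, M.θ a, b, M.θ b}

variable {M}

theorem mem_edgePair {a b d : D} :
    d ∈ M.edgePair a b ↔ d = a ∨ d = M.θ a ∨ d = b ∨ d = M.θ b := Iff.rfl

theorem edgePair_comm (a b : D) : M.edgePair a b = M.edgePair b a := by
  ext d; simp only [mem_edgePair]; tauto

theorem edgePair_θ (a b : D) : M.edgePair (M.θ b) (M.θ a) = M.edgePair a b := by
  ext d; simp only [mem_edgePair, M.θ_θ]; tauto

theorem θ_mem_edgePair {a b d : D} : M.θ d ∈ M.edgePair a b ↔ d ∈ M.edgePair a b := by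
  simp only [mem_edgePair, θ_eq_iff, M.θ_θ]; tauto

theorem IsTwoCycle.symm {a b : D} (h : M.IsTwoCycle a b) : M.IsTwoCycle b a :=
  ⟨h.src_eq.symm, h.tgt_eq.symm, by rw [← h.src_eq, ← h.tgt_eq]; exact h.not_loop, h.ne.symm⟩

theorem IsTwoCycle.θ {a b : D} (h : M.IsTwoCycle a b) : M.IsTwoCycle (M.θ b) (M.θ a) :=
  ⟨h.tgt_eq.symm, by simp only [tgt_θ, h.src_eq],
    by rw [src_θ, tgt_θ, ← h.src_eq, ← h.tgt_eq]; exact h.not_loop.symm,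
    fun h' => h.ne (M.θ.injective h'.symm)⟩

theorem IsRegion.θ_mem_iff {C T : Set D} (hT : M.IsRegion C T) {d : D} (h : d ∉ C)
    (h' : M.θ d ∉ C) : M.θ d ∈ T ↔ d ∈ T :=
  ⟨fun hd => M.θ_θ d ▸ hT.θ_mem _ hd h', fun hd => hT.θ_mem _ hd h⟩

theorem IsRegion.σ_mem {C T : Set D} (hT : M.IsRegion C T) {d : D} (hd : d ∈ T)
    (h : M.θ (M.σ d) ∉ C) : M.σ d ∈ T :=
  M.θ_φ d ▸ hT.θ_mem _ ((hT.φ_mem_iff d).2 hd) h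

theorem Submap.isRegion_side (H : M.Submap) (S : H.Side) :
    M.IsRegion H.darts {d | H.side (M.face d) = S} where
  φ_mem_iff d := by rw [Set.mem_ofPred_eq, face_φ, Set.mem_ofPred_eq]
  θ_mem d hd h := by
    rw [Set.mem_ofPred_eq] at hd ⊢
    rw [← hd]
    exact (Quotient.sound (Relation.EqvGen.rel _ _ ⟨d, h, rfl, rfl⟩)).symm

/-- Sides are the minimal regions: a region cannot be left by crossing an edge outside `H`, so it
contains every side that it meets. -/
theorem Submap.mem_of_side_eq {H : M.Submap} {T : Set D} (hT : M.IsRegion H.darts T) {d e : D}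
    (hd : d ∈ T) (h : H.side (M.face d) = H.side (M.face e)) : e ∈ T := by
  have h1 : Relation.EqvGen H.FaceAdj (M.face d) (M.face e) := Quotient.exact h
  have face_iff : ∀ {x y : D}, M.face x = M.face y → (x ∈ T ↔ y ∈ T) := fun h =>
    (M.face_eq_face_iff.1 h).mem_iff hT.φ_mem_iff
  have key : ∀ f g, Relation.EqvGen H.FaceAdj f g →
      ∀ x y, M.face x = f → M.face y = g → (x ∈ T ↔ y ∈ T) := by
    intro f g hfg
    induction hfg with
    | rel f g h =>
      obtain ⟨z, hz, rfl, rfl⟩ := h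
      intro x y hx hy
      rw [face_iff hx, face_iff hy]
      refine (hT.θ_mem_iff hz fun h => hz ?_).symm
      exact M.θ_θ z ▸ H.θ_mem _ h
    | refl f => exact fun x y hx hy => face_iff (hx.trans hy.symm)
    | symm f g _ ih => exact fun x y hx hy => (ih y x hy hx).symm
    | trans f g k _ _ ih1 ih2 =>
      intro x y hx hy
      obtain ⟨z, rfl⟩ : ∃ z, M.face z = g := Quotient.exists_rep g
      exact (ih1 x z hx rfl).trans (ih2 z y rfl hy)
  exact (key _ _ h1 d e rfl rfl).1 hd

theorem eq_or_eq_of_mem_edgePair {a b d : D} (h : M.IsTwoCycle a b) (hd : d ∈ M.edgePair a b)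
    (hs : M.src d = M.src a) : d = a ∨ d = b := by
  rcases hd with rfl | rfl | rfl | rfl
  · exact Or.inl rfl
  · exact absurd hs.symm h.not_loop
  · exact Or.inr rfl
  · exact absurd (hs.symm.trans h.tgt_eq.symm) h.not_loop

theorem notMem_edgePair {a b d : D} (h : M.IsTwoCycle a b) (hs : M.src d ≠ M.src a)
    (ht : M.src d ≠ M.tgt a) : d ∉ M.edgePair a b := by
  rintro (rfl | rfl | rfl | rfl)
  · exact hs rfl
  · exact ht rfl
  · exact hs h.src_eq.symm
  · exact ht h.tgt_eq.symm

/-- If one directed edge that starts in a vertex which is not in the boundary 2-cycle is in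
a region, then all of them are. -/
theorem IsRegion.mem_of_src_eq [Finite D] {a b d e : D} {T : Set D}
    (hT : M.IsRegion (M.edgePair a b) T) (h : M.IsTwoCycle a b) (hd : d ∈ T)
    (hs : M.src d ≠ M.src a) (ht : M.src d ≠ M.tgt a) (he : M.src e = M.src d) : e ∈ T := by
  obtain ⟨n, rfl⟩ := (M.src_eq_src_iff.1 he.symm).exists_nat_pow_eq
  clear he
  induction n with
  | zero => exact hd
  | succ n ih =>
    rw [pow_succ', Equiv.Perm.mul_apply]
    have hsrc : M.src (M.σ ((M.σ ^ n) d)) = M.src d := by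
      rw [src_σ]
      exact M.src_eq_src_iff.2 (Equiv.Perm.sameCycle_pow_left.2 (.refl _ _))
    refine hT.σ_mem ih ?_
    rw [θ_mem_edgePair]
    exact notMem_edgePair h (hsrc ▸ hs) (hsrc ▸ ht)

open Classical in
/-- A region bounded by a 2-cycle is on opposite sides of its two edges. -/
theorem IsRegion.sum_eq_zero [Finite D] {a b : D} {T : Set D} (h : M.IsTwoCycle a b)
    (hT : M.IsRegion (M.edgePair a b) T) :
    ((if a ∈ T then 1 else 0) - (if M.θ a ∈ T then 1 else 0) : ℤ) +
      ((if b ∈ T then 1 else 0) - (if M.θ b ∈ T then 1 else 0)) = 0 := by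
  cases nonempty_fintype D
  -- Since `θ (σ d) = φ d` is in `T` exactly when `d` is, the number of `d` at the vertex with `θ d
  -- ∈ T` equals the number with `d ∈ T`. Edges off the cycle count equally on both sides and
  -- cancel.
  have h1 := M.sum_σ (fun d => if M.θ d ∈ T then (1 : ℤ) else 0) (M.src a)
  simp only [← φ_apply, hT.φ_mem_iff] at h1
  have h2 : ∑ d with M.src d = M.src a,
      ((if d ∈ T then 1 else 0) - (if M.θ d ∈ T then 1 else 0) : ℤ) = 0 := by
    rw [Finset.sum_sub_distrib, h1, sub_self]
  refine Eq.trans ?_ h2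
  have hsub : ({a, b} : Finset D) ⊆ Finset.univ.filter fun d => M.src d = M.src a := by
    intro d hd
    rcases Finset.mem_insert.1 hd with rfl | hd
    · simp
    · rw [Finset.mem_singleton.1 hd]
      simp [h.src_eq]
  rw [← Finset.sum_subset hsub, Finset.sum_pair h.ne]
  intro d hd hd'
  have hC : d ∉ M.edgePair a b := fun hC => hd' (by
    simpa using eq_or_eq_of_mem_edgePair h hC (Finset.mem_filter.1 hd).2)
  rw [if_congr (hT.θ_mem_iff hC (θ_mem_edgePair.not.2 hC)) rfl rfl, sub_self]

theorem IsRegion.orientation [Finite D] (hM : M.graph.Connected) {a b : D} {T : Set D}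
    (h : M.IsTwoCycle a b) (hT : M.IsRegion (M.edgePair a b) T) (hne : T.Nonempty)
    (hne' : ∃ d, d ∉ T) :
    (a ∈ T ∧ M.θ a ∉ T ∧ b ∉ T ∧ M.θ b ∈ T) ∨ (b ∈ T ∧ M.θ b ∉ T ∧ a ∉ T ∧ M.θ a ∈ T) := by
  have hsum := hT.sum_eq_zero h
  -- If neither edge separated `T` from its complement, `T` would be closed under `θ`, hence
  -- everything.
  have key : ¬ ((M.θ a ∈ T ↔ a ∈ T) ∧ (M.θ b ∈ T ↔ b ∈ T)) := by
    rintro ⟨h1, h2⟩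
    obtain ⟨d, hd⟩ := hne'
    refine hd (eq_univ_of_connected hM hT.φ_mem_iff (fun e he => ?_) hne d)
    by_cases hC : e ∈ M.edgePair a b
    · rcases hC with rfl | rfl | rfl | rfl
      · exact h1.2 he
      · rw [M.θ_θ]; exact h1.1 he
      · exact h2.2 he
      · rw [M.θ_θ]; exact h2.1 he
    · exact hT.θ_mem e he hC
  by_cases h1 : a ∈ T <;> by_cases h2 : M.θ a ∈ T <;> by_cases h3 : b ∈ T <;>
    by_cases h4 : M.θ b ∈ T <;> simp [h1, h2, h3, h4] at hsum key ⊢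

end Region

end CombMap

/-! ### Free regions -/

namespace LopspOperation

open CombMap

variable {D : Type*} {O : LopspOperation D}

/-- `T` is a union of faces of `O` with boundary the 2-cycle with edges `a` and `b`, and none of
the special vertices is in its interior. -/
structure IsFreeRegion (O : LopspOperation D) (a b : D) (T : Set D) : Prop extends
    O.IsTwoCycle a b, O.IsRegion (O.edgePair a b) T where
  free : ∀ i, ∀ d ∈ T, O.src d = O.v i → O.v i = O.src a ∨ O.v i = O.tgt a
  fst_mem : a ∈ T
  θ_fst : O.θ a ∉ T
  snd : b ∉ T
  θ_snd_mem : O.θ b ∈ T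

/-- The symmetry that exchanges the two vertices of the cycle; arguments at `src a` then also apply
at `tgt a`. -/
theorem IsFreeRegion.θ {a b : D} {T : Set D} (h : O.IsFreeRegion a b T) :
    O.IsFreeRegion (O.θ b) (O.θ a) T where
  toIsTwoCycle := h.toIsTwoCycle.θ
  toIsRegion := by rw [edgePair_θ]; exact h.toIsRegion
  free i d hd hi := by
    rw [src_θ, tgt_θ, ← h.tgt_eq, ← h.src_eq]
    exact (h.free i d hd hi).symm
  fst_mem := h.θ_snd_mem
  θ_fst := by rw [O.θ_θ]; exact h.snd
  snd := h.θ_fst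
  θ_snd_mem := by rw [O.θ_θ]; exact h.fst_mem

theorem exists_v_ne (O : LopspOperation D) (x y : O.Vertex) : ∃ i, O.v i ≠ x ∧ O.v i ≠ y := by
  by_contra! H
  have h01 := O.v_injective.ne (show (0 : Fin 3) ≠ 1 by decide)
  have h02 := O.v_injective.ne (show (0 : Fin 3) ≠ 2 by decide)
  have h12 := O.v_injective.ne (show (1 : Fin 3) ≠ 2 by decide)
  rcases eq_or_ne (O.v 0) x with h0 | h0 <;> rcases eq_or_ne (O.v 1) x with h1 | h1 <;>
    rcases eq_or_ne (O.v 2) x with h2 | h2 <;> grind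

theorem exists_isFreeRegion [Finite D] {a b : D} {T : Set D} (h : O.IsTwoCycle a b)
    (hT : O.IsRegion (O.edgePair a b) T) (hne : T.Nonempty)
    (free : ∀ i, ∀ d ∈ T, O.src d = O.v i → O.v i = O.src a ∨ O.v i = O.tgt a) :
    O.IsFreeRegion a b T ∨ O.IsFreeRegion b a T := by
  have hne' : ∃ d, d ∉ T := by
    obtain ⟨i, h1, h2⟩ := O.exists_v_ne (O.src a) (O.tgt a)
    obtain ⟨d, hd⟩ := O.exists_src_eq (O.v i)
    exact ⟨d, fun hdT => (free i d hdT hd).elim h1 h2⟩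
  rcases hT.orientation O.isPlane.1 h hne hne' with ⟨h1, h2, h3, h4⟩ | ⟨h1, h2, h3, h4⟩
  · exact Or.inl ⟨h, hT, free, h1, h2, h3, h4⟩
  · exact Or.inr ⟨h.symm, edgePair_comm a b ▸ hT, h.src_eq ▸ h.tgt_eq ▸ free, h1, h2, h3, h4⟩

/-- A side without special vertices is itself a free region, and a free region contains a whole
side. Both orders of `a` and `b` occur because a free region fixes which edge is which. -/
theorem forall_side_iff [Finite D] {a b : D} (h : O.IsTwoCycle a b) :
    (∀ S : (twoCycle h).Side, ∃ i, O.v i ∈ (twoCycle h).interiorVerts S) ↔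
      ∀ T, ¬ O.IsFreeRegion a b T ∧ ¬ O.IsFreeRegion b a T := by
  have hC : (twoCycle h).darts = O.edgePair a b := rfl
  constructor
  · intro H T
    have key : O.IsRegion (O.edgePair a b) T → T.Nonempty →
        (∀ i, ∀ d ∈ T, O.src d = O.v i → O.v i = O.src a ∨ O.v i = O.tgt a) → False := by
      rintro hT ⟨d, hd⟩ free
      obtain ⟨i, hi, e, he, hes⟩ := H ((twoCycle h).side (O.face d))
      exact hi (free i e (Submap.mem_of_side_eq hT hd hes.symm) he)
    exact ⟨fun hT => key hT.toIsRegion ⟨_, hT.fst_mem⟩ hT.free,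
      fun hT => key (edgePair_comm a b ▸ hT.toIsRegion) ⟨_, hT.fst_mem⟩
        (h.src_eq ▸ h.tgt_eq ▸ hT.free)⟩
  · intro H S
    by_contra! hS
    have hT := (twoCycle h).isRegion_side S
    rw [hC] at hT
    rcases exists_isFreeRegion h hT (by
      obtain ⟨f, rfl⟩ := Quotient.exists_rep S
      obtain ⟨d, rfl⟩ := Quotient.exists_rep f
      exact ⟨d, rfl⟩) (fun i d hd hi => by
        by_contra hv
        exact hS i ⟨hv, d, hi, hd⟩) with hT | hT
    · exact (H _).1 hT
    · exact (H _).2 hT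

end LopspOperation

namespace CombMap

/-! ### Paths and the boundary walk of the outer face -/

section Paths

variable {D : Type*} {M : CombMap D}

theorem walkVerts_cons (u : M.Vertex) (d : D) (P : List D) :
    M.walkVerts u (d :: P) = u :: M.walkVerts (M.tgt d) P := rfl

theorem IsWalk.src_getElem {u w : M.Vertex} {P : List D} (h : M.IsWalk u P w) {i : ℕ}
    (hi : i < P.length) : M.src P[i] = (M.walkVerts u P)[i]'(by simp [walkVerts]; omega) := by
  induction P generalizing u i with
  | nil => simp at hi
  | cons d P ih =>
    cases i with
    | zero => exact h.1
    | succ i => exact ih h.2 (by simpa using hi)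

/-- The indexed vertices of a path. -/
theorem IsPath.exists_index {u w : M.Vertex} {P : List D} (h : M.IsPath u P w) :
    ∃ U : ℕ → M.Vertex, (∀ i (hi : i < P.length), M.src P[i] = U i ∧ M.tgt P[i] = U (i + 1)) ∧
      (∀ i ≤ P.length, ∀ j ≤ P.length, U i = U j → i = j) ∧
      ∀ x ∈ M.walkVerts u P, ∃ i ≤ P.length, U i = x := by
  have hl : (M.walkVerts u P).length = P.length + 1 := by simp [walkVerts]
  -- The default `u` never matters: the claims only involve indices up to `P.length`.
  refine ⟨fun i => (M.walkVerts u P).getD i u, fun i hi => ⟨?_, ?_⟩, fun i hi j hj hij => ?_,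
    fun x hx => ?_⟩
  · beta_reduce
    rw [List.getD_eq_getElem _ _ (by omega), h.1.src_getElem]
  · beta_reduce
    rw [List.getD_eq_getElem _ _ (by omega)]
    simp [walkVerts]
  · beta_reduce at hij
    rw [List.getD_eq_getElem _ _ (by omega), List.getD_eq_getElem _ _ (by omega)] at hij
    exact (h.2.getElem_inj_iff).1 hij
  · obtain ⟨i, hi, rfl⟩ := List.getElem_of_mem hx
    exact ⟨i, by omega, List.getD_eq_getElem _ _ hi⟩

theorem mem_boundaryWalk {P : List D} {d : D} :
    d ∈ M.boundaryWalk P ↔ ∃ k, ∃ hk : k < P.length, d = P[k] ∨ d = M.θ P[k] := by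
  simp only [boundaryWalk, List.mem_append, List.mem_reverse, List.mem_map]
  constructor
  · rintro (h | ⟨e, h, rfl⟩)
    · obtain ⟨i, hi, rfl⟩ := List.getElem_of_mem h
      exact ⟨i, hi, .inl rfl⟩
    · obtain ⟨i, hi, rfl⟩ := List.getElem_of_mem h
      exact ⟨i, hi, .inr rfl⟩
  · rintro ⟨k, hk, rfl | rfl⟩
    · exact .inl (List.getElem_mem _)
    · exact .inr ⟨_, List.getElem_mem _, rfl⟩

theorem θ_mem_boundaryWalk_iff {P : List D} {d : D} :
    M.θ d ∈ M.boundaryWalk P ↔ d ∈ M.boundaryWalk P :=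
  ⟨fun h => M.θ_θ d ▸ M.θ_mem_boundaryWalk h, M.θ_mem_boundaryWalk⟩

theorem IsPath.exists_mem_boundaryWalk {u w x : M.Vertex} {P : List D} (h : M.IsPath u P w)
    (hP : P ≠ []) (hx : x ∈ M.walkVerts u P) : ∃ d ∈ M.boundaryWalk P, M.src d = x := by
  obtain ⟨U, h1, h2, h3⟩ := h.exists_index
  obtain ⟨i, hi, rfl⟩ := h3 x hx
  have := List.length_pos_of_ne_nil hP
  rcases hi.lt_or_eq with hi | hi
  · exact ⟨_, mem_boundaryWalk.2 ⟨i, hi, .inl rfl⟩, (h1 i hi).1⟩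
  · refine ⟨_, mem_boundaryWalk.2 ⟨P.length - 1, by omega, .inr rfl⟩, ?_⟩
    rw [src_θ, (h1 _ _).2, hi]
    congr 1; omega

theorem IsPath.nodup_boundaryWalk {u w : M.Vertex} {P : List D} (h : M.IsPath u P w) :
    (M.boundaryWalk P).Nodup := by
  obtain ⟨U, h1, h2, -⟩ := h.exists_index
  have hP : P.Nodup := by
    have := h.2
    rw [walkVerts, List.nodup_cons] at this
    exact this.2.of_map
  refine List.nodup_append.2 ⟨List.nodup_reverse.2 hP, hP.map M.θ.injective, ?_⟩
  rintro d hd e he rfl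
  rw [List.mem_reverse] at hd
  obtain ⟨e, he', hde⟩ := List.mem_map.1 he
  obtain ⟨i, hi, rfl⟩ := List.getElem_of_mem hd
  obtain ⟨j, hj, rfl⟩ := List.getElem_of_mem he'
  have e1 : U (j + 1) = U i := by rw [← (h1 i hi).1, ← hde, src_θ, (h1 j hj).2]
  have e2 : U j = U (i + 1) := by rw [← (h1 i hi).2, ← hde, tgt_θ, (h1 j hj).1]
  have := h2 _ (by omega) _ (by omega) e1
  have := h2 _ (by omega) _ (by omega) e2
  omega

open Classical in
/-- The cyclic permutation of the directed edges in the outer face of a map cut along a path. -/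
noncomputable abbrev outerPerm (M : CombMap D) (P : List D) :
    Equiv.Perm {d // d ∈ M.boundaryWalk P} := (M.boundaryWalk P).attach.formPerm

open Classical in
theorem IsPath.outerPerm_getElem {u w : M.Vertex} {P : List D}
    (h : M.IsPath u P w) {i : ℕ} (hi : i < (M.boundaryWalk P).length) :
    (M.outerPerm P ⟨(M.boundaryWalk P)[i], List.getElem_mem hi⟩ : D) =
      (M.boundaryWalk P)[(i + 1) % (M.boundaryWalk P).length]'(Nat.mod_lt _ (by omega)) := by
  have := List.formPerm_apply_getElem (M.boundaryWalk P).attach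
    (List.nodup_attach.2 h.nodup_boundaryWalk) i (by simpa using hi)
  simp only [List.getElem_attach] at this
  rw [outerPerm, this]
  simp

/-- `P[k]` is at position `P.length - 1 - k` of the boundary walk, whose first half is reversed; at
`k = 0` the walk turns around at the start of the path. -/
theorem IsPath.outerPerm_apply {u w : M.Vertex} {P : List D}
    (h : M.IsPath u P w) {k : ℕ} (hk : k < P.length) (hm : _ ∈ _) :
    (M.outerPerm P ⟨P[k], hm⟩ : D) = if k = 0 then M.θ P[0] else P[k - 1] := by
  have hl : (M.boundaryWalk P).length = 2 * P.length := by simp [boundaryWalk]; omega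
  have := h.outerPerm_getElem (i := P.length - 1 - k) (by omega)
  have e1 : (M.boundaryWalk P)[P.length - 1 - k]'(by omega) = P[k] := by
    simp only [boundaryWalk]
    rw [List.getElem_append_left (by simp; omega), List.getElem_reverse]
    congr 1; omega
  simp only [e1] at this
  rw [this]
  simp only [boundaryWalk]
  split_ifs with h0
  · subst h0
    rw [List.getElem_append_right (by simp; rw [Nat.mod_eq_of_lt] <;> omega), List.getElem_map]
    congr 2
    simp; rw [Nat.mod_eq_of_lt] <;> omega
  · rw [List.getElem_append_left (by simp; rw [Nat.mod_eq_of_lt] <;> omega), List.getElem_reverse]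
    congr 1
    simp; rw [Nat.mod_eq_of_lt] <;> omega

theorem IsPath.outerPerm_apply_θ {u w : M.Vertex} {P : List D}
    (h : M.IsPath u P w) {k : ℕ} (hk : k < P.length) (hm : _ ∈ _) :
    (M.outerPerm P ⟨M.θ P[k], hm⟩ : D) =
      if hk' : k + 1 < P.length then M.θ P[k + 1] else P[k] := by
  have hl : (M.boundaryWalk P).length = 2 * P.length := by simp [boundaryWalk]; omega
  have := h.outerPerm_getElem (i := P.length + k) (by omega)
  have e1 : (M.boundaryWalk P)[P.length + k]'(by omega) = M.θ P[k] := by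
    simp only [boundaryWalk]
    rw [List.getElem_append_right (by simp), List.getElem_map]
    congr 2; simp
  simp only [e1] at this
  rw [this]
  simp only [boundaryWalk]
  split_ifs with h0
  · rw [List.getElem_append_right (by simp; rw [Nat.mod_eq_of_lt] <;> omega), List.getElem_map]
    congr 2
    simp; rw [Nat.mod_eq_of_lt] <;> omega
  · have hz : (P.length + k + 1) % (P.reverse ++ List.map M.θ P).length = 0 := by
      have : P.length + k + 1 = (P.reverse ++ List.map M.θ P).length := by simp; omega
      rw [this, Nat.mod_self]
    rw [List.getElem_append_left (by simp only [hz]; simp; omega), List.getElem_reverse]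
    congr 1
    simp only [hz]; omega

theorem IsPath.tgt_outerPerm {u w : M.Vertex} {P : List D}
    (h : M.IsPath u P w) (p : {e // e ∈ M.boundaryWalk P}) : M.tgt (M.outerPerm P p) = M.src p.1 := by
  obtain ⟨U, h1, h2, -⟩ := h.exists_index
  obtain ⟨d, hd⟩ := p
  obtain ⟨k, hk, rfl | rfl⟩ := mem_boundaryWalk.1 hd
  · rw [h.outerPerm_apply hk]
    split_ifs with h0
    · subst h0; rw [tgt_θ]
    · rw [(h1 _ _).1, (h1 _ _).2]; congr 1; omega
  · rw [h.outerPerm_apply_θ hk]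
    split_ifs with h0
    · rw [tgt_θ, src_θ, (h1 _ _).1, (h1 _ _).2]
    · rfl

/-- At each vertex of a path, at most two directed edges start that are in the path or are inverse
to one in the path. -/
theorem IsPath.eq_or_eq_of_src_eq {u w : M.Vertex} {P : List D}
    (h : M.IsPath u P w) (p : {e // e ∈ M.boundaryWalk P}) {d : D} (hd : d ∈ M.boundaryWalk P) (hs : M.src d = M.src p.1) :
    d = p.1 ∨ d = M.θ (M.outerPerm P p) := by
  obtain ⟨U, h1, h2, -⟩ := h.exists_index
  obtain ⟨e, he⟩ := p
  obtain ⟨k, hk, rfl | rfl⟩ := mem_boundaryWalk.1 he <;>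
    obtain ⟨j, hj, rfl | rfl⟩ := mem_boundaryWalk.1 hd <;>
    simp only [src_θ, (h1 _ _).1, (h1 _ _).2] at hs <;>
    have := h2 _ (by omega) _ (by omega) hs
  · subst this; exact .inl rfl
  · subst this
    right
    rw [h.outerPerm_apply hk, if_neg (by omega)]; rfl
  · right
    rw [h.outerPerm_apply_θ hk, dif_pos (by omega), M.θ_θ]
    congr 1
  · left
    congr 2; omega

end Paths

end CombMap

namespace CombMap

/-! ### Rotation in the cut map -/

section Cut

variable {D : Type*} {M : CombMap D} {P : List D}

/-- The directed edge of `M` of which a directed edge of a map cut along a path is a copy. -/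
def CutDart.proj : M.CutDart P → D
  | .inl d => d
  | .inr d => d

theorem cut_θ_inr (d) : (M.cut P).θ (.inr d) = .inl (M.θ d) := rfl

theorem cut_θ_inl_of_mem {d : D} (h : d ∈ M.boundaryWalk P) :
    (M.cut P).θ (.inl d) = .inr ⟨M.θ d, M.θ_mem_boundaryWalk h⟩ := by
  change M.cutInv P (.inl d) = _
  simp [cutInv, h]

theorem cut_θ_inl_of_notMem {d : D} (h : d ∉ M.boundaryWalk P) :
    (M.cut P).θ (.inl d) = .inl (M.θ d) := by
  change M.cutInv P (.inl d) = _
  simp [cutInv, h]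

theorem cut_φ_inl (d : D) : (M.cut P).φ (.inl d) = .inl (M.φ d) := by
  rw [φ, cut_face_perm]; rfl

theorem cut_φ_inr (d) : (M.cut P).φ (.inr d) = .inr (M.outerPerm P d) := by
  rw [φ, cut_face_perm]; rfl

/-- Old faces keep their face permutation, so rotation agrees with that of `M` until it meets an
edge of `P`, where it passes to an `inr` copy. -/
theorem cut_σ_inl (d : D) : (M.cut P).σ (.inl d) = (M.cut P).θ (.inl (M.φ d)) := by
  rw [← cut_φ_inl, θ_φ]

theorem cut_σ_inl_of_notMem {d : D} (h : M.σ d ∉ M.boundaryWalk P) :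
    (M.cut P).σ (.inl d) = .inl (M.σ d) := by
  rw [cut_σ_inl, cut_θ_inl_of_notMem (by rwa [φ_apply, θ_mem_boundaryWalk_iff]), θ_φ]

theorem cut_σ_inl_of_mem {d : D} (h : M.σ d ∈ M.boundaryWalk P) :
    (M.cut P).σ (.inl d) = .inr ⟨M.σ d, h⟩ := by
  rw [cut_σ_inl, cut_θ_inl_of_mem (by rwa [φ_apply, θ_mem_boundaryWalk_iff])]
  simp only [θ_φ]

theorem cut_σ_inr (d) : (M.cut P).σ (.inr d) = .inl (M.θ (M.outerPerm P d)) := by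
  rw [← cut_θ_inr, ← cut_φ_inr, θ_φ]

theorem proj_θ (d : M.CutDart P) : ((M.cut P).θ d).proj = M.θ d.proj := by
  rcases d with d | d
  · by_cases h : d ∈ M.boundaryWalk P
    · rw [cut_θ_inl_of_mem h]; rfl
    · rw [cut_θ_inl_of_notMem h]; rfl
  · rfl

variable {u w : M.Vertex} (hP : M.IsPath u P w)
include hP

theorem IsPath.src_proj_σ (d : M.CutDart P) : M.src ((M.cut P).σ d).proj = M.src d.proj := by
  rcases d with d | d
  · rw [cut_σ_inl, proj_θ]
    exact M.tgt_φ d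
  · rw [cut_σ_inr]
    exact hP.tgt_outerPerm d

theorem IsPath.src_proj_eq {d e : M.CutDart P} (h : (M.cut P).src d = (M.cut P).src e) :
    M.src d.proj = M.src e.proj :=
  ((M.cut P).src_eq_src_iff.1 h).apply_eq_apply (g := fun d : M.CutDart P => M.src d.proj)
    hP.src_proj_σ

theorem IsPath.tgt_proj_eq {d e : M.CutDart P} (h : (M.cut P).tgt d = (M.cut P).tgt e) :
    M.tgt d.proj = M.tgt e.proj := by
  have := hP.src_proj_eq h
  rwa [proj_θ, proj_θ] at this

/-- Every vertex of a map cut along a path has at most one corner in the outer face. -/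
theorem IsPath.eq_of_src_inr_eq [Finite D] {p q : {d // d ∈ M.boundaryWalk P}}
    (h : (M.cut P).src (.inr p) = (M.cut P).src (.inr q)) : p = q := by
  -- The successor of `inr p` in the cut map is `inl d`. In `M`, rotation from `d` first returns to
  -- the path at `p`, as `p` and `d` are the only candidates; so the orbit of `inr p` has no other
  -- `inr` element.
  set d := M.θ (M.outerPerm P p) with hd
  have hdP : d ∈ M.boundaryWalk P := M.θ_mem_boundaryWalk (M.outerPerm P p).2
  have hsrc : M.src d = M.src p.1 := hP.tgt_outerPerm p
  have hex : ∃ m : ℕ, 0 < m ∧ (M.σ ^ m) d ∈ M.boundaryWalk P :=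
    ⟨orderOf M.σ, orderOf_pos _, by rwa [pow_orderOf_eq_one]⟩
  classical
  obtain ⟨hm, hmP⟩ := Nat.find_spec hex
  have hmin : ∀ j, 0 < j → j < Nat.find hex → (M.σ ^ j) d ∉ M.boundaryWalk P :=
    fun j hj hj' hjP => Nat.find_min hex hj' ⟨hj, hjP⟩
  set m := Nat.find hex
  have hsrcpow : ∀ j : ℕ, M.src ((M.σ ^ j) d) = M.src p.1 := by
    intro j
    rw [← hsrc]
    exact M.src_eq_src_iff.2 (Equiv.Perm.sameCycle_pow_left.2 (.refl _ _))
  have hmp : (M.σ ^ m) d = p.1 := by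
    rcases hP.eq_or_eq_of_src_eq p hmP (hsrcpow m) with h1 | h1
    · exact h1
    -- If the return is to `d` itself, then `p` lies in the orbit already traversed, which
    -- minimality of `m` permits only if `p = d`.
    · obtain ⟨j, hj⟩ := (M.src_eq_src_iff.1 hsrc).exists_nat_pow_eq
      have hper : Function.IsPeriodicPt M.σ m d := by
        rw [Function.IsPeriodicPt, Function.IsFixedPt, Equiv.Perm.iterate_eq_pow]; exact h1
      have hj' : (M.σ ^ (j % m)) d = p.1 := by
        rw [← hj, ← Equiv.Perm.iterate_eq_pow, ← Equiv.Perm.iterate_eq_pow,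
          hper.iterate_mod_apply]
      rcases Nat.eq_zero_or_pos (j % m) with h0 | h0
      · rw [h0, pow_zero, Equiv.Perm.one_apply] at hj'
        rw [h1, ← hd, hj']
      · exact absurd (hj' ▸ p.2) (hmin _ h0 (Nat.mod_lt _ hm))
  have key : ∀ n : ℕ, ((M.cut P).σ ^ n) (.inr p) = .inr p ∨
      ∃ j < m, ((M.cut P).σ ^ n) (.inr p) = .inl ((M.σ ^ j) d) := by
    intro n
    induction n with
    | zero => exact .inl rfl
    | succ n ih =>
      rw [pow_succ', Equiv.Perm.mul_apply]
      rcases ih with ih | ⟨j, hj, ih⟩ <;> rw [ih]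
      · exact .inr ⟨0, hm, cut_σ_inr p⟩
      · rcases (Nat.succ_le_of_lt hj).lt_or_eq with hj' | hj'
        · right
          refine ⟨j + 1, hj', ?_⟩
          rw [cut_σ_inl_of_notMem, pow_succ', Equiv.Perm.mul_apply]
          rw [← Equiv.Perm.mul_apply, ← pow_succ']
          exact hmin _ (Nat.succ_pos _) hj'
        · left
          have : M.σ ((M.σ ^ j) d) = p.1 := by
            rw [← Equiv.Perm.mul_apply, ← pow_succ', ← hmp, ← hj']
          rw [cut_σ_inl_of_mem (this ▸ p.2)]
          exact congrArg Sum.inr (Subtype.ext this)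
  have : Finite (M.CutDart P) := inferInstance
  obtain ⟨n, hn⟩ := ((M.cut P).src_eq_src_iff.1 h).exists_nat_pow_eq
  rcases key n with h1 | ⟨j, -, h1⟩ <;> rw [hn] at h1
  · exact (Sum.inr_injective h1).symm
  · exact absurd h1 (by simp)

end Cut

end CombMap

namespace CombMap

/-! ### A Jordan-type argument for 2-cycles in the cut map -/

section Jordan

variable {D : Type*} (M : CombMap D)

open Classical in
/-- The Kronecker delta modulo 2. -/
noncomputable def delta {α : Type*} (x y : α) : ZMod 2 := if x = y then 1 else 0

theorem delta_self {α : Type*} (x : α) : delta x x = 1 := if_pos rfl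

theorem delta_of_ne {α : Type*} {x y : α} (h : x ≠ y) : delta x y = 0 := if_neg h

theorem delta_congr {α β : Type*} {x y : α} {z w : β} (h : x = y ↔ z = w) :
    delta x y = delta z w := by
  by_cases hx : x = y
  · rw [delta, if_pos hx, delta, if_pos (h.1 hx)]
  · rw [delta_of_ne hx, delta_of_ne (h.not.1 hx)]

/-- The indicator function modulo 2 of two edges. -/
noncomputable def edgeCochain (a b d : D) : ZMod 2 :=
  delta d a + delta d (M.θ a) + (delta d b + delta d (M.θ b))

variable {M}

theorem edgeCochain_θ (a b d : D) : M.edgeCochain a b (M.θ d) = M.edgeCochain a b d := by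
  have h1 : ∀ x, delta (M.θ d) (M.θ x) = delta d x := fun x => delta_congr M.θ.injective.eq_iff
  have h2 : ∀ x, delta (M.θ d) x = delta d (M.θ x) := fun x => delta_congr M.θ_eq_iff
  simp only [edgeCochain, h1, h2]
  ring

theorem edgeCochain_eq_zero {a b d : D} (h : d ∉ M.edgePair a b) :
    M.edgeCochain a b d = 0 := by
  simp only [mem_edgePair, not_or] at h
  simp [edgeCochain, delta, h]

theorem sum_delta [Fintype D] [DecidableEq M.Vertex] (a : D) (u : M.Vertex) :
    ∑ d with M.src d = u, delta d a = delta (M.src a) u := by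
  by_cases h : M.src a = u
  · rw [Finset.sum_eq_single a (fun d _ h => delta_of_ne h) (by simp [h]), delta_self, h,
      delta_self]
  · rw [delta_of_ne h]
    refine Finset.sum_eq_zero fun d hd => delta_of_ne ?_
    rintro rfl
    exact h (Finset.mem_filter.1 hd).2

theorem sum_edgeCochain [Fintype D] [DecidableEq M.Vertex] {a b : D} (hs : M.src a = M.src b)
    (ht : M.tgt a = M.tgt b) (u : M.Vertex) :
    ∑ d with M.src d = u, M.edgeCochain a b d = 0 := by
  simp only [edgeCochain, Finset.sum_add_distrib, sum_delta, src_θ, hs, ht]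
  exact CharTwo.add_self_eq_zero _

variable {P : List D} {u w : M.Vertex}

theorem inl_eq_iff {d : D} (h : d ∉ M.boundaryWalk P) (e : M.CutDart P) :
    .inl d = e ↔ d = e.proj := by
  rcases e with e | e
  · exact Sum.inl_injective.eq_iff
  · simp only [reduceCtorEq, false_iff]
    rintro rfl
    exact h e.2

theorem edgeCochain_inl {d : D} (h : d ∉ M.boundaryWalk P) (a b : M.CutDart P) :
    (M.cut P).edgeCochain a b (.inl d) = M.edgeCochain a.proj b.proj d := by
  simp only [edgeCochain, delta_congr (inl_eq_iff h _), proj_θ]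

/-- If a potential for the projection of a 2-cycle in a map cut along a path is extended to
the outer face in such a way that it changes only along the 2-cycle, then it is constant there. -/
theorem IsPath.outer_potential_eq [Finite D] (hP : M.IsPath u P w) {a b : M.CutDart P}
    (hs : (M.cut P).src a = (M.cut P).src b) (ht : (M.cut P).tgt a = (M.cut P).tgt b)
    {g : D → ZMod 2} (hφ : ∀ d, g (M.φ d) = g d)
    (hθ : ∀ d, g (M.θ d) = g d + M.edgeCochain a.proj b.proj d)
    (p q : {d // d ∈ M.boundaryWalk P}) :
    g (M.θ p) + (M.cut P).edgeCochain a b (.inr p) =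
      g (M.θ q) + (M.cut P).edgeCochain a b (.inr q) := by
  classical
  cases nonempty_fintype D
  set c := (M.cut P).edgeCochain a b
  -- The value at an outer directed edge is forced by that at its inverse, which lies in an old
  -- face.
  let h : M.CutDart P → ZMod 2 := Sum.elim g fun d => g (M.θ d) + c (.inr d)
  have hcθ : ∀ d, c ((M.cut P).θ d) = c d := edgeCochain_θ a b
  have hhθ : ∀ d, h ((M.cut P).θ d) = h d + c d := by
    rintro (d | d)
    · by_cases hd : d ∈ M.boundaryWalk P
      · have := hcθ (.inl d)
        rw [cut_θ_inl_of_mem hd] at this ⊢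
        simp only [h, Sum.elim_inl, Sum.elim_inr, M.θ_θ, this]
      · rw [cut_θ_inl_of_notMem hd]
        simp only [h, Sum.elim_inl, hθ, c, edgeCochain_inl hd]
    · rw [cut_θ_inr]
      simp only [h, Sum.elim_inl, Sum.elim_inr]
      rw [add_assoc, CharTwo.add_self_eq_zero, add_zero]
  have hhσ : ∀ d, h ((M.cut P).σ d) = h ((M.cut P).φ d) + c ((M.cut P).σ d) := by
    intro d
    rw [← (M.cut P).θ_φ, hhθ, hcθ]
  -- Around a vertex the changes `c` sum to zero and `h` is `φ`-invariant at all old corners. The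
  -- single outer corner there must then be invariant too.
  have step : ∀ p, h (.inr (M.outerPerm P p)) = h (.inr p) := by
    intro p
    have h1 := (M.cut P).sum_σ h ((M.cut P).src (.inr p))
    simp only [hhσ, Finset.sum_add_distrib] at h1
    rw [(M.cut P).sum_σ c, sum_edgeCochain hs ht, add_zero, ← sub_eq_zero,
      ← Finset.sum_sub_distrib, Finset.sum_eq_single (.inr p)] at h1
    · rw [sub_eq_zero, cut_φ_inr] at h1
      exact h1
    · rintro (d | d) hd hdp
      · rw [cut_φ_inl]
        exact sub_eq_zero.2 (hφ d)
      · exact absurd (congrArg Sum.inr (hP.eq_of_src_inr_eq (Finset.mem_filter.1 hd).2)) hdp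
    · simp
  have hcyc := (List.nodup_attach.2 hP.nodup_boundaryWalk).isCycleOn_formPerm
  have hsame : (M.outerPerm P).SameCycle p q := by
    convert hcyc.2 (List.mem_attach _ p) (List.mem_attach _ q)
  exact hsame.apply_eq_apply (g := fun p => h (.inr p)) step

/-- If a 2-cycle in a map cut along a path projects to a single edge, then that edge is the
only one in the path. -/
theorem IsPath.eq_or_eq_of_proj_eq [Finite D] (hP : M.IsPath u P w)
    {a b : M.CutDart P} (h : (M.cut P).IsTwoCycle a b) (hab : a.proj = b.proj)
    {d : D} (hd : d ∈ M.boundaryWalk P) : d = a.proj ∨ d = M.θ a.proj := by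
  have main : ∀ p : {d // d ∈ M.boundaryWalk P}, (M.cut P).IsTwoCycle (.inl p) (.inr p) →
      d = p ∨ d = M.θ p := by
    intro p h
    by_contra! H
    -- The two copies project to one edge counted twice, so zero is a potential on `M`; its
    -- extension is 1 at the copy of `p` but 0 at any other path edge.
    have h0 := hP.outer_potential_eq h.src_eq h.tgt_eq (g := 0) (fun _ => rfl) (fun d =>
      (CharTwo.add_self_eq_zero _).symm.trans (zero_add _).symm) p ⟨d, hd⟩
    have h1 : (M.cut P).edgeCochain (.inl p) (.inr p) (.inr ⟨d, hd⟩) = 0 := by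
      refine edgeCochain_eq_zero ?_
      rw [mem_edgePair, cut_θ_inl_of_mem p.2, cut_θ_inr]
      simp [Subtype.ext_iff, H]
    have h2 : (M.cut P).edgeCochain (.inl p) (.inr p) (.inr p) = 1 := by
      rw [edgeCochain, cut_θ_inl_of_mem p.2, cut_θ_inr, delta_self, delta_of_ne (by simp),
        delta_of_ne (by simp [Subtype.ext_iff, (M.θ_ne _).symm]), delta_of_ne (by simp)]
      simp
    rw [h1, h2] at h0
    simp at h0
  rcases a with a | a <;> rcases b with b | b
  · exact absurd (congrArg Sum.inl hab) h.ne
  · obtain rfl : a = b := hab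
    exact main b h
  · obtain rfl : (a : D) = b := hab
    exact main a h.symm
  · exact absurd (congrArg Sum.inr (Subtype.ext hab)) h.ne

/-- A 2-cycle in a plane map cut along a path has a side that contains no vertices of the path. -/
theorem IsPath.exists_region [Finite D] (hM : M.IsPlane) (hP : M.IsPath u P w)
    {a b : M.CutDart P} (h : (M.cut P).IsTwoCycle a b)
    (hab : M.IsTwoCycle a.proj b.proj) (hne : P ≠ []) :
    ∃ T, M.IsRegion (M.edgePair a.proj b.proj) T ∧ T.Nonempty ∧
      ∀ d ∈ T, M.src d ∈ M.walkVerts u P →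
        M.src d = M.src a.proj ∨ M.src d = M.tgt a.proj := by
  classical
  cases nonempty_fintype D
  obtain ⟨g, hφ, hθ⟩ := exists_potential hM (edgeCochain_θ a.proj b.proj)
    (sum_edgeCochain hab.src_eq hab.tgt_eq)
  have hconst := hP.outer_potential_eq h.src_eq h.tgt_eq hφ hθ
  obtain ⟨p₀⟩ : Nonempty {d // d ∈ M.boundaryWalk P} :=
    ⟨P[0]'(List.length_pos_of_ne_nil hne), mem_boundaryWalk.2 ⟨0, _, .inl rfl⟩⟩
  -- The value on the outer face; the region sought is where `g` differs from it.
  set κ := g (M.θ p₀) + (M.cut P).edgeCochain a b (.inr p₀)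
  have hT : M.IsRegion (M.edgePair a.proj b.proj) {d | g d ≠ κ} :=
    { φ_mem_iff := fun d => by rw [Set.mem_ofPred_eq, hφ, Set.mem_ofPred_eq]
      θ_mem := fun d hd hC => by
        rw [Set.mem_ofPred_eq] at hd ⊢
        rwa [hθ, edgeCochain_eq_zero hC, add_zero] }
  refine ⟨_, hT, ?_, ?_⟩
  · by_contra! hempty
    have h1 : ∀ d, g d = κ := fun d => by
      by_contra hd
      exact Set.notMem_empty d (hempty ▸ hd)
    have h2 := hθ a.proj
    have h3 : a.proj ≠ M.θ b.proj := fun h3 => hab.not_loop (by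
      conv_lhs => rw [h3]
      exact hab.tgt_eq.symm)
    rw [h1, h1] at h2
    simp [edgeCochain, delta, hab.ne, h3, (M.θ_ne _).symm] at h2
  · intro d hd hdP
    by_contra! hC
    have hnot : ∀ e, M.src e = M.src d → e ∉ M.edgePair a.proj b.proj := fun e he =>
      notMem_edgePair hab (he ▸ hC.1) (he ▸ hC.2)
    obtain ⟨e, heP, he⟩ := hP.exists_mem_boundaryWalk hne hdP
    have heT : e ∈ {d | g d ≠ κ} := hT.mem_of_src_eq hab hd hC.1 hC.2 he
    refine heT ?_
    have h1 := hconst ⟨M.θ e, M.θ_mem_boundaryWalk heP⟩ p₀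
    rw [edgeCochain_eq_zero, M.θ_θ, add_zero] at h1
    · exact h1
    · rw [mem_edgePair]
      intro hmem
      refine hnot e he (θ_mem_edgePair.1 ?_)
      rcases hmem with h | h | h | h
      · exact .inl (congrArg CutDart.proj h)
      · exact .inr (.inl ((congrArg CutDart.proj h).trans (proj_θ _)))
      · exact .inr (.inr (.inl (congrArg CutDart.proj h)))
      · exact .inr (.inr (.inr ((congrArg CutDart.proj h).trans (proj_θ _))))

end Jordan

end CombMap

theorem Equiv.Perm.SameCycle.pow_card_apply {α : Type*} [Finite α] (f : Equiv.Perm α) (x : α)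
    {s : Set α} (hs : ∀ y, y ∈ s ↔ f.SameCycle x y) :
    (f ^ Nat.card s) x = x ∧ ∀ y ∈ s, ∃ n < Nat.card s, (f ^ n) x = y := by
  have := s.toFinite.fintype
  have hcyc : f.IsCycleOn (s.toFinset : Set α) := by
    rw [Set.coe_toFinset]
    refine ⟨⟨fun y hy => ?_, f.injective.injOn, fun y hy => ⟨f⁻¹ y, ?_, by simp⟩⟩,
      fun y hy z hz => ((hs y).1 hy).symm.trans ((hs z).1 hz)⟩
    · rw [hs] at hy ⊢
      exact Equiv.Perm.sameCycle_apply_right.2 hy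
    · rw [hs] at hy ⊢
      exact Equiv.Perm.sameCycle_apply_right.1 (by simpa using hy)
  have hx : x ∈ s.toFinset := Set.mem_toFinset.2 ((hs x).2 (.refl _ _))
  rw [Nat.card_eq_card_toFinset]
  exact ⟨hcyc.pow_card_apply hx, fun y hy => hcyc.exists_pow_eq hx (Set.mem_toFinset.2 hy)⟩

namespace CombMap

/-! ### Degrees and triangular faces -/

section Triangle

variable {D : Type*} [Finite D] {M : CombMap D}

theorem pow_degree (M : CombMap D) (d : D) : (M.σ ^ M.degree (M.src d)) d = d :=
  (Equiv.Perm.SameCycle.pow_card_apply M.σ d (s := {e | M.src e = M.src d}) fun e => by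
    rw [Set.mem_ofPred_eq, eq_comm, src_eq_src_iff]).1

theorem exists_pow_of_src_eq {d e : D} (h : M.src e = M.src d) :
    ∃ n < M.degree (M.src d), (M.σ ^ n) d = e :=
  (Equiv.Perm.SameCycle.pow_card_apply M.σ d (s := {e | M.src e = M.src d}) fun e => by
    rw [Set.mem_ofPred_eq, eq_comm, src_eq_src_iff]).2 e h

theorem IsTriangulation.φ_φ_φ (h : M.IsTriangulation) (d : D) : M.φ (M.φ (M.φ d)) = d := by
  have := (Equiv.Perm.SameCycle.pow_card_apply M.φ d (s := {e | M.face e = M.face d}) fun e => by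
    rw [Set.mem_ofPred_eq, eq_comm, face_eq_face_iff]).1
  have h3 : Nat.card {e | M.face e = M.face d} = 3 := h (M.face d)
  rw [h3] at this
  exact this

/-- The directed edges of a triangle. -/
def triangle (M : CombMap D) (d : D) : Set D := {d, M.φ d, M.φ (M.φ d)}

theorem IsTriangulation.φ_mem_triangle_iff (h : M.IsTriangulation) (d e : D) :
    M.φ e ∈ M.triangle d ↔ e ∈ M.triangle d := by
  have h3 := h.φ_φ_φ d
  simp only [triangle, Set.mem_insert_iff, Set.mem_singleton_iff]
  have h1 : M.φ e = d ↔ e = M.φ (M.φ d) := by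
    conv_lhs => rw [← h3]
    exact M.φ.injective.eq_iff
  rw [h1, M.φ.injective.eq_iff, M.φ.injective.eq_iff]
  tauto

theorem IsTriangulation.src_φ_φ (h : M.IsTriangulation) (d : D) :
    M.src (M.φ (M.φ d)) = M.tgt d := by
  rw [← M.tgt_φ, h.φ_φ_φ]

end Triangle

end CombMap

/-! ### Removing vertices of colour 1 from the boundary of a free region -/

namespace LopspOperation

open CombMap

variable {D : Type*} [Finite D] {O : LopspOperation D}

/-- The ends of two consecutive edges at a vertex are joined by the third edge of their triangle.
Around a vertex of colour 1 the colours 0 and 2 therefore alternate. -/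
theorem colour_tgt_ne (O : LopspOperation D) (d : D) :
    O.colour (O.tgt d) ≠ O.colour (O.tgt (O.σ d)) := by
  have := O.proper (O.φ (O.φ d))
  rwa [O.isTriangulation.src_φ_φ, O.tgt_φ, O.src_φ] at this

/-- Around a vertex of colour 1 on a 2-cycle there are four directed edges, and those of the
2-cycle are opposite to each other. -/
theorem opposite_of_colour_eq_one {a b : D} (h : O.IsTwoCycle a b)
    (hc : O.colour (O.src a) = 1) :
    (∀ i, O.v i ≠ O.src a) ∧ O.σ (O.σ a) = b ∧ O.σ (O.σ (O.σ (O.σ a))) = a := by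
  have hσ : b ≠ O.σ a := by
    rintro rfl
    exact O.colour_tgt_ne a (congrArg _ h.tgt_eq)
  have hv : ∀ i, O.v i ≠ O.src a := by
    intro i hi
    obtain rfl : i = 1 := by
      fin_cases i
      · exact absurd (hi ▸ hc) O.colour_v0
      · rfl
      · exact absurd (hi ▸ hc) O.colour_v2
    have hdeg := O.degree_v1 (hi ▸ hc)
    rw [hi] at hdeg
    obtain ⟨n, hn, hb⟩ := exists_pow_of_src_eq h.src_eq.symm
    rw [hdeg] at hn
    interval_cases n
    · exact h.ne hb
    · exact hσ hb.symm
  have hdeg := O.degree_of_colour_one _ (fun i => (hv i).symm) hc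
  have h4 := O.pow_degree a
  rw [hdeg] at h4
  refine ⟨hv, ?_, h4⟩
  obtain ⟨n, hn, hb⟩ := exists_pow_of_src_eq h.src_eq.symm
  rw [hdeg] at hn
  interval_cases n
  · exact absurd hb h.ne
  · exact absurd hb.symm hσ
  · exact hb
  · have h5 : O.σ b = a := by rw [← hb]; exact h4
    have := O.colour_tgt_ne b
    rw [h5, h.tgt_eq] at this
    exact absurd rfl this

/-- The edges at `src a` are `a`, `s`, `b`, `t` in cyclic order, and `e₁`, `e₂`, `e₃`, `e₄` are the
edges opposite `src a` in the triangles following them. The triangles of `a` and `s` lie in `T`.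
Either `e₁` and `e₂` bound the rest of `T`, or they are the same edge and `e₃`, `e₄` bound the union
of the four triangles. -/
theorem exists_isFreeRegion_of_colour_eq_one {a b : D} {T : Set D} (hT : O.IsFreeRegion a b T)
    (hc : O.colour (O.src a) = 1) :
    ∃ a' b' T', O.IsFreeRegion a' b' T' ∧ O.colour (O.src a') ≠ 1 ∧
      O.colour (O.tgt a') ≠ 1 := by
  have tri := O.isTriangulation
  obtain ⟨hv, hb, ha⟩ := opposite_of_colour_eq_one hT.toIsTwoCycle hc
  obtain ⟨s, hs⟩ : ∃ s, s = O.σ a := ⟨_, rfl⟩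
  obtain ⟨t, ht⟩ : ∃ t, t = O.σ b := ⟨_, rfl⟩
  rw [← hs] at hb
  rw [← hs, hb, ← ht] at ha
  have φa : O.φ a = O.θ s := by rw [φ_apply, hs]
  have φs : O.φ s = O.θ b := by rw [φ_apply, hb]
  have φb : O.φ b = O.θ t := by rw [φ_apply, ht]
  have φt : O.φ t = O.θ a := by rw [φ_apply, ha]
  have srcs : O.src s = O.src a := by rw [hs, src_σ]
  have srct : O.src t = O.src a := by rw [ht, src_σ, hT.src_eq]
  have cy : O.colour (O.tgt a) ≠ 1 := fun h => O.proper a (hc.trans h.symm)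
  have cs : O.colour (O.tgt s) ≠ 1 := fun h => O.proper s (by rw [srcs, hc, h])
  have ct : O.colour (O.tgt t) ≠ 1 := fun h => O.proper t (by rw [srct, hc, h])
  have cys : O.colour (O.tgt a) ≠ O.colour (O.tgt s) := hs ▸ O.colour_tgt_ne a
  have cyt : O.colour (O.tgt a) ≠ O.colour (O.tgt t) := by
    rw [hT.tgt_eq, ht]; exact O.colour_tgt_ne b
  obtain ⟨e₁, he₁⟩ : ∃ e, e = O.φ (O.φ a) := ⟨_, rfl⟩
  obtain ⟨e₂, he₂⟩ : ∃ e, e = O.φ (O.φ s) := ⟨_, rfl⟩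
  obtain ⟨e₃, he₃⟩ : ∃ e, e = O.φ (O.φ b) := ⟨_, rfl⟩
  obtain ⟨e₄, he₄⟩ : ∃ e, e = O.φ (O.φ t) := ⟨_, rfl⟩
  have srce₁ : O.src e₁ = O.tgt a := by rw [he₁, tri.src_φ_φ]
  have tgte₁ : O.tgt e₁ = O.tgt s := by rw [he₁, tgt_φ, φa, src_θ]
  have srce₂ : O.src e₂ = O.tgt s := by rw [he₂, tri.src_φ_φ]
  have tgte₂ : O.tgt e₂ = O.tgt a := by rw [he₂, tgt_φ, φs, src_θ, hT.tgt_eq]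
  have srce₃ : O.src e₃ = O.tgt a := by rw [he₃, tri.src_φ_φ, hT.tgt_eq]
  have tgte₃ : O.tgt e₃ = O.tgt t := by rw [he₃, tgt_φ, φb, src_θ]
  have srce₄ : O.src e₄ = O.tgt t := by rw [he₄, tri.src_φ_φ]
  have tgte₄ : O.tgt e₄ = O.tgt a := by rw [he₄, tgt_φ, φt, src_θ]
  have finish : ∀ {c d : D} {T' : Set D}, O.IsTwoCycle c d → O.IsRegion (O.edgePair c d) T' →
      T'.Nonempty → (∀ i, ∀ e ∈ T', O.src e = O.v i → O.v i = O.src c ∨ O.v i = O.tgt c) →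
      O.colour (O.src c) ≠ 1 → O.colour (O.tgt c) ≠ 1 → ∃ a' b' T', O.IsFreeRegion a' b' T' ∧
        O.colour (O.src a') ≠ 1 ∧ O.colour (O.tgt a') ≠ 1 := by
    intro c d T' h1 h2 h3 h4 h5 h6
    rcases exists_isFreeRegion h1 h2 h3 h4 with h | h
    · exact ⟨c, d, T', h, h5, h6⟩
    · exact ⟨d, c, T', h, h1.src_eq ▸ h5, h1.tgt_eq ▸ h6⟩
  have trian_a : O.triangle a = {a, O.θ s, e₁} := by rw [triangle, ← he₁, φa]
  have trian_s : O.triangle s = {s, O.θ b, e₂} := by rw [triangle, ← he₂, φs]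
  have trian_b : O.triangle b = {b, O.θ t, e₃} := by rw [triangle, ← he₃, φb]
  have trian_t : O.triangle t = {t, O.θ a, e₄} := by rw [triangle, ← he₄, φt]
  have sT : s ∈ T := by
    have : O.φ s ∈ T := φs ▸ hT.θ_snd_mem
    exact (hT.φ_mem_iff s).1 this
  have e₁T : e₁ ∈ T := by
    rw [he₁, hT.φ_mem_iff, hT.φ_mem_iff]; exact hT.fst_mem
  have e₂T : e₂ ∈ T := by
    rw [he₂, hT.φ_mem_iff, hT.φ_mem_iff]; exact sT
  by_cases h12 : e₁ = O.θ e₂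
  · have hvs : ∀ i, O.v i ≠ O.tgt s := by
      intro i hi
      rcases hT.free i e₂ e₂T (srce₂.trans hi.symm) with h | h
      · exact hv i h
      · exact cys (by rw [← h, hi])
    have h12' : O.θ e₁ = e₂ := O.θ_eq_iff.2 h12
    let T' : Set D := {d | d ∈ O.triangle a ∨ d ∈ O.triangle s ∨ d ∈ O.triangle b ∨
      d ∈ O.triangle t}
    have hφ : ∀ d, O.φ d ∈ T' ↔ d ∈ T' := fun d => by
      simp only [T', Set.mem_ofPred_eq, tri.φ_mem_triangle_iff]
    have hθ : ∀ d ∈ T', d ≠ e₃ → d ≠ e₄ → O.θ d ∈ T' := by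
      intro d hd h3 h4
      simp only [T', Set.mem_ofPred_eq, trian_a, trian_b, trian_s, trian_t, Set.mem_insert_iff,
        Set.mem_singleton_iff] at hd ⊢
      rcases hd with (h | h | h) | (h | h | h) | (h | h | h) | (h | h | h) <;>
        first
        | exact absurd h h3
        | exact absurd h h4
        | simp only [h, O.θ_θ, h12', ← h12, true_or, or_true]
    have hfree : ∀ i, ∀ d ∈ T', O.src d = O.v i → O.v i = O.tgt a ∨ O.v i = O.tgt t := by
      intro i d hd hi
      simp only [T', Set.mem_ofPred_eq, trian_a, trian_b, trian_s, trian_t, Set.mem_insert_iff,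
        Set.mem_singleton_iff] at hd
      rcases hd with (h | h | h) | (h | h | h) | (h | h | h) | (h | h | h) <;>
        simp only [h, src_θ, srcs, srct, srce₁, srce₂, srce₃, srce₄, ← hT.src_eq, ← hT.tgt_eq]
          at hi <;>
        first
        | exact absurd hi.symm (hv i)
        | exact absurd hi.symm (hvs i)
        | exact .inl hi.symm
        | exact .inr hi.symm
    have haT : a ∈ T' := by simp [T', trian_a]
    by_cases h34 : e₃ = O.θ e₄
    -- If `e₃` and `e₄` coincide as well, the four triangles are the whole map, which leaves only
    -- two possible places for the three special vertices.
    · exfalso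
      have h34' : O.θ e₃ = e₄ := O.θ_eq_iff.2 h34
      have huniv : ∀ d, d ∈ T' := eq_univ_of_connected O.isPlane.1 hφ (fun d hd => by
        by_cases h3 : d = e₃
        · rw [h3, h34']; simp [T', trian_t]
        · by_cases h4 : d = e₄
          · rw [h4, ← h34]; simp [T', trian_b]
          · exact hθ d hd h3 h4) ⟨a, haT⟩
      obtain ⟨i, h1, h2⟩ := O.exists_v_ne (O.tgt a) (O.tgt t)
      obtain ⟨d, hd⟩ := O.exists_src_eq (O.v i)
      exact (hfree i d (huniv d) hd).elim h1 h2
    · refine finish (c := e₃) (d := O.θ e₄) (T' := T') ⟨?_, ?_, ?_, h34⟩ ⟨hφ, ?_⟩ ⟨a, haT⟩ ?_ ?_ ?_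
      · rw [srce₃, src_θ, tgte₄]
      · rw [tgte₃, tgt_θ, srce₄]
      · rw [srce₃, tgte₃]; exact fun h => cyt (by rw [h])
      · intro d hd hC
        simp only [mem_edgePair, O.θ_θ, not_or] at hC
        exact hθ d hd hC.1 hC.2.2.2
      · rwa [srce₃, tgte₃]
      · rwa [srce₃]
      · rwa [tgte₃]
  · have hθT : ∀ d ∈ T, d ≠ a → d ≠ O.θ b → O.θ d ∈ T := by
      intro d hd h1 h2
      refine hT.θ_mem d hd ?_
      rintro (rfl | rfl | rfl | rfl)
      · exact h1 rfl
      · exact hT.θ_fst hd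
      · exact hT.snd hd
      · exact h2 rfl
    have src₁ : O.tgt a ≠ O.src a := fun h => cy (h ▸ hc)
    refine finish (c := e₁) (d := O.θ e₂)
      (T' := {d | d ∈ T ∧ d ∉ O.triangle a ∧ d ∉ O.triangle s}) ⟨?_, ?_, ?_, h12⟩ ⟨?_, ?_⟩
      ⟨O.θ e₁, ?_, ?_, ?_⟩ ?_ ?_ ?_
    · rw [srce₁, src_θ, tgte₂]
    · rw [tgte₁, tgt_θ, srce₂]
    · rw [srce₁, tgte₁]; exact fun h => cys (by rw [h])
    · intro d
      simp only [Set.mem_ofPred_eq, tri.φ_mem_triangle_iff, hT.φ_mem_iff]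
    · rintro d ⟨hd, hda, hds⟩ hC
      simp only [mem_edgePair, O.θ_θ, not_or] at hC
      rw [trian_a] at hda
      rw [trian_s] at hds
      simp only [Set.mem_insert_iff, Set.mem_singleton_iff, not_or] at hda hds
      refine ⟨hθT d hd hda.1 hds.2.1, ?_, ?_⟩
      · rw [trian_a]
        simp only [Set.mem_insert_iff, Set.mem_singleton_iff, θ_eq_iff, O.θ_θ]
        rintro (h | h | h)
        · exact hT.θ_fst (h ▸ hd)
        · exact hds.1 h
        · exact hC.2.1 h
      · rw [trian_s]
        simp only [Set.mem_insert_iff, Set.mem_singleton_iff, θ_eq_iff, O.θ_θ]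
        rintro (h | h | h)
        · exact hda.2.1 h
        · exact hT.snd (h ▸ hd)
        · exact hC.2.2.1 h
    · refine hθT e₁ e₁T ?_ ?_
      · rintro rfl; exact src₁ srce₁.symm
      · rintro rfl
        rw [tgt_θ, ← hT.src_eq] at tgte₁
        exact cs (tgte₁ ▸ hc)
    · rw [trian_a]
      rintro (h | h | h)
      · rw [θ_eq_iff] at h
        rw [h, tgt_θ] at tgte₁
        exact cs (tgte₁ ▸ hc)
      · rw [O.θ.injective.eq_iff] at h
        rw [h, srcs] at srce₁
        exact src₁ srce₁.symm
      · exact O.θ_ne _ h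
    · rw [trian_s]
      rintro (h | h | h)
      · rw [θ_eq_iff] at h
        rw [h, tgt_θ, srcs] at tgte₁
        exact cs (tgte₁ ▸ hc)
      · rw [O.θ.injective.eq_iff] at h
        rw [h, ← hT.src_eq] at srce₁
        exact src₁ srce₁.symm
      · exact h12 (O.θ_eq_iff.1 h)
    · rintro i d ⟨hd, -, -⟩ hi
      rcases hT.free i d hd hi with h | h
      · exact absurd h (hv i)
      · exact .inl (h.trans srce₁.symm)
    · rwa [srce₁]
    · rwa [tgte₁]

theorem exists_isFreeRegion_colour_ne_one {a b : D} {T : Set D} (hT : O.IsFreeRegion a b T) :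
    ∃ a' b' T', O.IsFreeRegion a' b' T' ∧ O.colour (O.src a') ≠ 1 ∧
      O.colour (O.tgt a') ≠ 1 := by
  by_cases h1 : O.colour (O.src a) = 1
  · exact exists_isFreeRegion_of_colour_eq_one hT h1
  by_cases h2 : O.colour (O.tgt a) = 1
  · exact exists_isFreeRegion_of_colour_eq_one hT.θ (by rw [src_θ, ← hT.tgt_eq, h2])
  exact ⟨a, b, T, hT, h1, h2⟩

end LopspOperation

namespace CombMap

/-! ### Existence of a path through a third vertex -/

section PathSurgery

variable {D : Type*} {M : CombMap D}

theorem isWalk_append {u w : M.Vertex} {P Q : List D} :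
    M.IsWalk u (P ++ Q) w ↔ ∃ x, M.IsWalk u P x ∧ M.IsWalk x Q w := by
  induction P generalizing u with
  | nil => simp [IsWalk]
  | cons d P ih => simp only [List.cons_append, IsWalk, ih, and_assoc, exists_and_left]

theorem walkVerts_append (u : M.Vertex) (P Q : List D) :
    M.walkVerts u (P ++ Q) = M.walkVerts u P ++ Q.map M.tgt := by
  simp [walkVerts]

theorem IsWalk.exists_append {u w x : M.Vertex} {P : List D} (h : M.IsWalk u P w)
    (hx : x ∈ M.walkVerts u P) : ∃ Q R, P = Q ++ R ∧ M.IsWalk u Q x ∧ M.IsWalk x R w := by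
  induction P generalizing u with
  | nil =>
    obtain rfl : x = u := by simpa [walkVerts] using hx
    exact ⟨[], [], rfl, rfl, h⟩
  | cons d P ih =>
    rcases List.mem_cons.1 hx with rfl | hx
    · exact ⟨[], d :: P, rfl, rfl, h⟩
    · obtain ⟨Q, R, rfl, hQ, hR⟩ := ih h.2 hx
      exact ⟨d :: Q, R, rfl, ⟨h.1, hQ⟩, hR⟩

theorem IsWalk.mem_map_tgt {u w : M.Vertex} {P : List D} (h : M.IsWalk u P w) (hne : u ≠ w) :
    w ∈ P.map M.tgt := by
  induction P generalizing u with
  | nil => exact absurd h hne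
  | cons d P ih =>
    rw [List.map_cons, List.mem_cons]
    by_cases hw : M.tgt d = w
    · exact .inl hw.symm
    · exact .inr (ih h.2 hw)

theorem exists_isPath (hM : M.graph.Connected) (u w : M.Vertex) : ∃ P, M.IsPath u P w := by
  obtain ⟨p, hp⟩ := (hM.preconnected u w).exists_isPath
  have key : ∀ u w (p : M.graph.Walk u w), ∃ P, M.IsWalk u P w ∧ M.walkVerts u P = p.support := by
    intro u w p
    induction p with
    | nil => exact ⟨[], rfl, rfl⟩
    | cons h p ih =>
      obtain ⟨P, hP, hs⟩ := ih
      obtain ⟨-, ⟨d, rfl, rfl⟩ | ⟨d, rfl, rfl⟩⟩ := h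
      · exact ⟨d :: P, ⟨rfl, hP⟩, by rw [walkVerts_cons, hs]; rfl⟩
      · refine ⟨M.θ d :: P, ⟨rfl, ?_⟩, ?_⟩
        · rwa [tgt_θ]
        · rw [walkVerts_cons, tgt_θ, hs]; rfl
  obtain ⟨P, hP, hs⟩ := key u w p
  exact ⟨P, hP, hs ▸ hp.support_nodup⟩

/-- The edge of `d` is in a path from `u` to `w`. -/
def IsOnPath (M : CombMap D) (u w : M.Vertex) (d : D) : Prop :=
  ∃ P, M.IsPath u P w ∧ (d ∈ P ∨ M.θ d ∈ P)

theorem isOnPath_θ {u w : M.Vertex} {d : D} : M.IsOnPath u w (M.θ d) ↔ M.IsOnPath u w d := by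
  simp only [IsOnPath, M.θ_θ, or_comm]

/-- If the third vertex of the triangle is off the path, replace `e` by `f`, `g`. If it is on the
path, before or after `e`, shortcuts through one side of the triangle use `f` and `g` in turn. Edges
on paths from `u` to `w` thus spread over triangles and, by connectedness, over the whole map. -/
theorem IsPath.isOnPath_of_triangle {u w : M.Vertex} {P Q : List D} {e f g : D}
    (h : M.IsPath u (P ++ e :: Q) w) (hf : M.src f = M.src e) (hfg : M.tgt f = M.src g)
    (hg : M.tgt g = M.tgt e) (hs : M.src g ≠ M.src e) (ht : M.src g ≠ M.tgt e) :
    M.IsOnPath u w f ∧ M.IsOnPath u w g := by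
  obtain ⟨hwalk, hnodup⟩ := h
  obtain ⟨x, hP, rfl, hQ⟩ := isWalk_append.1 hwalk
  rw [walkVerts_append, List.map_cons] at hnodup
  by_cases h1 : M.src g ∈ M.walkVerts u P
  · obtain ⟨R, S, rfl, hR, hS⟩ := hP.exists_append h1
    rw [walkVerts_append, List.append_assoc] at hnodup
    constructor
    · refine ⟨R ++ M.θ f :: e :: Q, ⟨isWalk_append.2 ⟨_, hR, hfg, ?_, hQ⟩, ?_⟩, .inr (by simp)⟩
      · rw [tgt_θ, hf]
      · rw [walkVerts_append, List.map_cons, List.map_cons, tgt_θ, hf]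
        refine hnodup.sublist ((List.Sublist.refl _).append ?_)
        exact (List.singleton_sublist.2 (hS.mem_map_tgt hs)).append (List.Sublist.refl _)
    · refine ⟨R ++ g :: Q, ⟨isWalk_append.2 ⟨_, hR, rfl, hg ▸ hQ⟩, ?_⟩, .inl (by simp)⟩
      rw [walkVerts_append, List.map_cons, hg]
      exact hnodup.sublist ((List.Sublist.refl _).append (List.sublist_append_right _ _))
  by_cases h2 : M.src g ∈ M.walkVerts (M.tgt e) Q
  · obtain ⟨R, S, rfl, hR, hS⟩ := hQ.exists_append h2
    rw [List.map_append] at hnodup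
    have hZ := List.singleton_sublist.2 (hR.mem_map_tgt ht.symm)
    constructor
    · refine ⟨P ++ f :: S, ⟨isWalk_append.2 ⟨_, hP, hf, hfg ▸ hS⟩, ?_⟩, .inl (by simp)⟩
      rw [walkVerts_append, List.map_cons, hfg]
      refine hnodup.sublist ((List.Sublist.refl _).append ?_)
      exact (hZ.append (List.Sublist.refl _)).cons _
    · refine ⟨P ++ e :: M.θ g :: S, ⟨isWalk_append.2 ⟨_, hP, rfl, hg, ?_⟩, ?_⟩, .inr (by simp)⟩
      · rwa [tgt_θ]
      · rw [walkVerts_append, List.map_cons, List.map_cons, tgt_θ]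
        refine hnodup.sublist ((List.Sublist.refl _).append ?_)
        exact (hZ.append (List.Sublist.refl _)).cons_cons _
  · have : M.IsPath u (P ++ f :: g :: Q) w := by
      refine ⟨isWalk_append.2 ⟨_, hP, hf, hfg.symm, hg ▸ hQ⟩, ?_⟩
      rw [walkVerts_append, List.map_cons, List.map_cons, hfg, hg, List.nodup_middle,
        List.nodup_cons]
      refine ⟨fun h => ?_, hnodup⟩
      exact (List.mem_append.1 h).elim h1 h2
    exact ⟨⟨_, this, .inl (by simp)⟩, ⟨_, this, .inl (by simp)⟩⟩

theorem isOnPath_φ [Finite D] (hM : M.IsTriangulation) (hl : ∀ d, M.src d ≠ M.tgt d)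
    {u w : M.Vertex} {d : D} (h : M.IsOnPath u w d) : M.IsOnPath u w (M.φ d) := by
  have h1 := M.tgt_φ d
  have h2 := M.tgt_φ (M.φ d)
  have h3 := hM.src_φ_φ d
  have l1 := hl (M.φ d)
  have l2 := hl (M.φ (M.φ d))
  rw [h1] at l1
  rw [h2, h3] at l2
  obtain ⟨P, hP, h | h⟩ := h <;> obtain ⟨Q, R, rfl⟩ := List.append_of_mem h
  · refine isOnPath_θ.1 (hP.isOnPath_of_triangle (f := M.θ (M.φ d)) (g := M.θ (M.φ (M.φ d)))
      ?_ ?_ ?_ ?_ ?_).1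
    · rw [src_θ, h1]
    · rw [tgt_θ, src_θ, h2]
    · rw [tgt_θ, h3]
    · rw [src_θ, h2]; exact l1
    · rw [src_θ, h2]; exact l2.symm
  · refine (hP.isOnPath_of_triangle (f := M.φ (M.φ d)) (g := M.φ d) ?_ ?_ ?_ ?_ ?_).2
    · rw [src_θ, h3]
    · rw [h2]
    · rw [tgt_θ, h1]
    · rw [src_θ]; exact l2.symm
    · rw [tgt_θ]; exact l1

/-- In a triangulation without loops, every vertex is on a path between two given vertices. -/
theorem exists_isPath_through [Finite D] (hM : M.graph.Connected) (hM' : M.IsTriangulation)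
    (hl : ∀ d, M.src d ≠ M.tgt d) {u w : M.Vertex} (hne : u ≠ w) (x : M.Vertex) :
    ∃ P, M.IsPath u P w ∧ x ∈ M.walkVerts u P := by
  obtain ⟨P, hP⟩ := exists_isPath hM u w
  obtain ⟨e, he⟩ : ∃ e, M.IsOnPath u w e := by
    cases P with
    | nil => exact absurd hP.1 hne
    | cons e P => exact ⟨e, _, hP, .inl (by simp)⟩
  obtain ⟨d, rfl⟩ := M.exists_src_eq x
  obtain ⟨Q, hQ, hd⟩ := eq_univ_of_connected hM (T := {d | M.IsOnPath u w d})
    (fun d => ⟨fun h => by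
      have := isOnPath_φ hM' hl (isOnPath_φ hM' hl h)
      rwa [hM'.φ_φ_φ] at this, isOnPath_φ hM' hl⟩)
    (fun d => isOnPath_θ.2) ⟨e, he⟩ d
  refine ⟨Q, hQ, ?_⟩
  rcases hd with h | h <;> obtain ⟨R, S, rfl⟩ := List.append_of_mem h
  · obtain ⟨y, h1, rfl, h2⟩ := isWalk_append.1 hQ.1
    rw [walkVerts_append]
    by_cases hu : u = M.src d
    · exact List.mem_append_left _ (hu ▸ List.mem_cons_self)
    · exact List.mem_append_left _ (List.mem_cons_of_mem _ (h1.mem_map_tgt hu))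
  · rw [walkVerts_append, List.map_cons, tgt_θ]
    simp

end PathSurgery

end CombMap

namespace CombMap

/-! ### Rerouting cut-paths around a free region -/

section Lift

variable {D : Type*} {M : CombMap D}

theorem exists_first {α : Type*} {p : α → Prop} {l : List α} (h : ∃ x ∈ l, p x) :
    ∃ r x s, l = r ++ x :: s ∧ p x ∧ ∀ y ∈ r, ¬ p y := by
  induction l with
  | nil => simp at h
  | cons a l ih =>
    by_cases ha : p a
    · exact ⟨[], a, l, rfl, ha, by simp⟩
    · obtain ⟨r, x, s, rfl, hx, hr⟩ := ih (by
        obtain ⟨x, hx, hpx⟩ := h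
        rcases List.mem_cons.1 hx with rfl | hx
        · exact absurd hpx ha
        · exact ⟨x, hx, hpx⟩)
      refine ⟨a :: r, x, s, rfl, hx, fun y hy => ?_⟩
      rcases List.mem_cons.1 hy with rfl | hy
      · exact ha
      · exact hr y hy

theorem IsWalk.end_mem {u w : M.Vertex} {d : D} {P : List D} (h : M.IsWalk u (d :: P) w) :
    w ∈ (d :: P).map M.tgt := by
  rw [List.map_cons, List.mem_cons]
  by_cases hw : M.tgt d = w
  · exact .inl hw.symm
  · exact .inr (h.2.mem_map_tgt hw)

end Lift

end CombMap

namespace LopspOperation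

open CombMap

variable {D : Type*} {O : LopspOperation D}

theorem IsFreeRegion.tgt_ne_v {a b d : D} {T : Set D} (hT : O.IsFreeRegion a b T) (hd : d ∈ T)
    (hC : d ∉ O.edgePair a b) (hs : O.tgt d ≠ O.src a) (ht : O.tgt d ≠ O.tgt a) (i : Fin 3) :
    O.tgt d ≠ O.v i := fun h =>
  (hT.free i (O.θ d) (hT.θ_mem d hd hC) h).elim (h ▸ hs) (h ▸ ht)

theorem IsCutPath.v_mem {P : List D} (hP : O.IsCutPath P) (i : Fin 3) :
    O.v i ∈ O.walkVerts (O.v 1) P := by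
  fin_cases i
  · exact hP.2
  · exact List.mem_cons_self
  · exact List.mem_cons_of_mem _
      (hP.1.1.mem_map_tgt (O.v_injective.ne (show (1 : Fin 3) ≠ 2 by decide)))

variable [Finite D]

/-- A walk that enters the interior of a free region leaves it through the boundary before it
reaches a special vertex. -/
theorem IsFreeRegion.exists_exit {a b d : D} {T : Set D} (hT : O.IsFreeRegion a b T)
    (hd : d ∈ T) (hC : d ∉ O.edgePair a b) {P : List D} {i : Fin 3}
    (hP : O.IsWalk (O.tgt d) P (O.v i)) :
    ∃ Q R z, P = Q ++ R ∧ O.IsWalk (O.tgt d) Q z ∧ O.IsWalk z R (O.v i) ∧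
      (z = O.src a ∨ z = O.tgt a) ∧ ∀ x ∈ (d :: Q).map O.tgt, x = z ∨ ∀ j, x ≠ O.v j := by
  induction P generalizing d with
  | nil =>
    refine ⟨[], [], O.tgt d, rfl, rfl, hP, ?_, by simp⟩
    by_contra! h
    exact hT.tgt_ne_v hd hC h.1 h.2 i hP
  | cons e P ih =>
    by_cases hs : O.tgt d = O.src a ∨ O.tgt d = O.tgt a
    · exact ⟨[], e :: P, O.tgt d, rfl, rfl, hP, hs, by simp⟩
    rw [not_or] at hs
    obtain ⟨Q, R, z, rfl, hQ, hR, hz, hint⟩ := ih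
      (hT.mem_of_src_eq hT.toIsTwoCycle (hT.θ_mem d hd hC) hs.1 hs.2 hP.1)
      (notMem_edgePair hT.toIsTwoCycle (hP.1 ▸ hs.1) (hP.1 ▸ hs.2)) hP.2
    refine ⟨e :: Q, R, z, rfl, ⟨hP.1, hQ⟩, hR, hz, fun x hx => ?_⟩
    rcases List.mem_cons.1 hx with rfl | hx
    · exact .inr (hT.tgt_ne_v hd hC hs.1 hs.2)
    · exact hint x hx

/-- A cut-path that enters the interior of a free region can be replaced by one that is not longer
and that has fewer directed edges in the interior of the region. -/
theorem IsFreeRegion.exists_shortcut {a b : D} {T : Set D} (hT : O.IsFreeRegion a b T)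
    (p : D → Bool) (hp : ∀ d, p d = true ↔ d ∈ T ∧ d ∉ O.edgePair a b) {P : List D}
    (hP : O.IsCutPath P) (hbad : ∃ d ∈ P, p d = true) :
    ∃ P', O.IsCutPath P' ∧ P'.length ≤ P.length ∧ P'.countP p < P.countP p := by
  obtain ⟨P₁, d, R, rfl, hd, hP₁⟩ := exists_first hbad
  obtain ⟨⟨hwalk, hnodup⟩, hv0⟩ := hP
  obtain ⟨u, h1, rfl, h2⟩ := isWalk_append.1 hwalk
  have hd' := (hp d).1 hd
  -- Otherwise the path starts at an interior vertex, though `v 1` is special, or the preceding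
  -- directed edge is also in the interior, contradicting the choice of `d` as the first.
  have hsrc : O.src d = O.src a ∨ O.src d = O.tgt a := by
    by_contra! hs
    rcases List.eq_nil_or_concat' P₁ with rfl | ⟨P₂, e, rfl⟩
    · exact (hT.free 1 d hd'.1 h1.symm).elim (h1 ▸ hs.1) (h1 ▸ hs.2)
    · obtain ⟨-, -, -, he⟩ := isWalk_append.1 h1
      have he' : O.src (O.θ e) = O.src d := he
      have hθe : O.θ e ∉ O.edgePair a b :=
        notMem_edgePair hT.toIsTwoCycle (he' ▸ hs.1) (he' ▸ hs.2)
      have := hT.θ_mem _ (hT.mem_of_src_eq hT.toIsTwoCycle hd'.1 hs.1 hs.2 he') hθe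
      rw [O.θ_θ] at this
      exact hP₁ e (by simp) ((hp e).2 ⟨this, fun h => hθe (θ_mem_edgePair.2 h)⟩)
  obtain ⟨Q, S, z, rfl, hQ, hS, hz, hint⟩ := hT.exists_exit hd'.1 hd'.2 h2
  have hzmem : z ∈ (d :: Q).map O.tgt := IsWalk.end_mem (u := O.src d) ⟨rfl, hQ⟩
  rw [← List.cons_append, walkVerts_append, List.map_append] at hnodup hv0
  have hzne : O.src d ≠ z := by
    rintro rfl
    have hmem : O.src d ∈ O.walkVerts (O.v 1) P₁ := by
      by_cases hu : O.v 1 = O.src d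
      · exact hu ▸ List.mem_cons_self
      · exact List.mem_cons_of_mem _ (h1.mem_map_tgt hu)
    exact (List.nodup_append.1 hnodup).2.2 _ hmem _ (List.mem_append_left _ hzmem) rfl
  obtain ⟨e, heC, hes, het⟩ : ∃ e ∈ O.edgePair a b, O.src e = O.src d ∧ O.tgt e = z := by
    rcases hsrc with hs | hs <;> rcases hz with hz | hz
    · exact absurd (hs.trans hz.symm) hzne
    · exact ⟨a, .inl rfl, hs.symm, hz.symm⟩
    · exact ⟨O.θ a, .inr (.inl rfl), hs.symm, by rw [tgt_θ, hz]⟩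
    · exact absurd (hs.trans hz.symm) hzne
  refine ⟨P₁ ++ e :: S, ⟨⟨isWalk_append.2 ⟨_, h1, hes, het ▸ hS⟩, ?_⟩, ?_⟩, ?_, ?_⟩
  · rw [walkVerts_append, List.map_cons, het]
    exact hnodup.sublist ((List.Sublist.refl _).append
      ((List.singleton_sublist.2 hzmem).append (List.Sublist.refl _)))
  · rw [walkVerts_append, List.map_cons, het]
    -- The shortcut keeps `v 0`: every discarded vertex other than `z` is not special.
    rcases List.mem_append.1 hv0 with h | h
    · exact List.mem_append_left _ h
    refine List.mem_append_right _ ?_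
    rcases List.mem_append.1 h with h | h
    · rcases hint _ h with h | h
      · exact h ▸ List.mem_cons_self
      · exact absurd rfl (h 0)
    · exact List.mem_cons_of_mem _ h
  · simp
  · have he : p e = false := by
      rw [← Bool.not_eq_true, hp]
      exact fun h => h.2 heC
    simp only [List.countP_append, List.countP_cons, hd, he]
    simp

theorem exists_isMinCutPath_avoiding {a b : D} {T : Set D} (hT : O.IsFreeRegion a b T) :
    ∃ P, O.IsMinCutPath P ∧ ∀ d ∈ O.boundaryWalk P, d ∈ T → d ∈ O.edgePair a b := by
  classical
  let p : D → Bool := fun d => decide (d ∈ T ∧ d ∉ O.edgePair a b)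
  have hp : ∀ d, p d = true ↔ d ∈ T ∧ d ∉ O.edgePair a b := fun d => decide_eq_true_iff
  have hex : ∃ n, ∃ P, O.IsCutPath P ∧ P.length = n := by
    obtain ⟨P, hP, h0⟩ := exists_isPath_through O.isPlane.1 O.isTriangulation
      (fun d h => O.proper d (congrArg _ h)) (O.v_injective.ne (show (1 : Fin 3) ≠ 2 by decide))
      (O.v 0)
    exact ⟨_, P, ⟨hP, h0⟩, rfl⟩
  -- Among the shortest cut-paths, take one with the fewest interior directed edges.
  have hex' : ∃ n, ∃ P, O.IsMinCutPath P ∧ P.countP p = n := by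
    obtain ⟨P, hP, hl⟩ := Nat.find_spec hex
    exact ⟨_, P, ⟨hP, fun P' hP' => hl ▸ Nat.find_min' hex ⟨P', hP', rfl⟩⟩, rfl⟩
  obtain ⟨P, hP, hcount⟩ := Nat.find_spec hex'
  have hgood : ∀ d ∈ P, ¬ (d ∈ T ∧ d ∉ O.edgePair a b) := by
    intro d hd hbad
    obtain ⟨P', hP', hl, hc⟩ := hT.exists_shortcut p hp hP.1 ⟨d, hd, (hp d).2 hbad⟩
    exact Nat.find_min hex' (hcount ▸ hc)
      ⟨P', ⟨hP', fun P'' h => hl.trans (hP.2 P'' h)⟩, rfl⟩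
  refine ⟨P, hP, fun d hd hdT => ?_⟩
  by_contra hC
  obtain ⟨k, hk, rfl | rfl⟩ := mem_boundaryWalk.1 hd
  · exact hgood _ (List.getElem_mem hk) ⟨hdT, hC⟩
  · have := hT.θ_mem _ hdT hC
    rw [O.θ_θ] at this
    exact hgood _ (List.getElem_mem hk) ⟨this, fun h => hC (θ_mem_edgePair.2 h)⟩

/-! ### Free regions of the map and 2-cycles of the cut map -/

/-- Rotation from `a` inside `T` meets no path edge before reaching `b`, so it is the same in the
cut map. It ends at the copy of `b` bordering `T`, which is the inverse of `inl (θ b)` whether or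
not `b` is on the path. -/
theorem IsFreeRegion.src_cut_eq {a b : D} {T : Set D} (hT : O.IsFreeRegion a b T) {P : List D}
    (hP : ∀ d ∈ O.boundaryWalk P, d ∈ T → d ∈ O.edgePair a b) :
    (O.cut P).src (.inl a) = (O.cut P).src ((O.cut P).θ (.inl (O.θ b))) := by
  classical
  have hex : ∃ m : ℕ, 0 < m ∧ (O.σ ^ m) a ∈ O.edgePair a b :=
    ⟨orderOf O.σ, orderOf_pos _, by rw [pow_orderOf_eq_one]; exact .inl rfl⟩
  obtain ⟨hm, hmC⟩ := Nat.find_spec hex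
  have hmin : ∀ j, 0 < j → j < Nat.find hex → (O.σ ^ j) a ∉ O.edgePair a b :=
    fun j hj hj' hjP => Nat.find_min hex hj' ⟨hj, hjP⟩
  obtain ⟨m, hm'⟩ := Nat.exists_eq_succ_of_ne_zero hm.ne'
  rw [hm'] at hmC hmin
  have key : ∀ j ≤ m, (O.σ ^ j) a ∈ T ∧ ((O.cut P).σ ^ j) (.inl a) = .inl ((O.σ ^ j) a) := by
    intro j hj
    induction j with
    | zero => exact ⟨hT.fst_mem, rfl⟩
    | succ j ih =>
      obtain ⟨ih1, ih2⟩ := ih (by omega)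
      have hC := hmin (j + 1) (by omega) (by omega)
      rw [pow_succ', Equiv.Perm.mul_apply] at hC
      have hmem := hT.σ_mem ih1 (by rwa [θ_mem_edgePair])
      rw [pow_succ', Equiv.Perm.mul_apply, pow_succ', Equiv.Perm.mul_apply, ih2]
      exact ⟨hmem, cut_σ_inl_of_notMem fun h => hC (hP _ h hmem)⟩
  obtain ⟨h1, h2⟩ := key m le_rfl
  have hb : O.φ ((O.σ ^ m) a) = O.θ b := by
    have hmem := (hT.φ_mem_iff _).2 h1
    rw [Nat.succ_eq_add_one, pow_succ', Equiv.Perm.mul_apply] at hmC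
    rw [φ_apply] at hmem ⊢
    rcases eq_or_eq_of_mem_edgePair hT.toIsTwoCycle hmC (by
      rw [src_σ]
      exact O.src_eq_src_iff.2 (Equiv.Perm.sameCycle_pow_left.2 (.refl _ _))) with h | h
    · rw [h] at hmem
      exact absurd hmem hT.θ_fst
    · rw [h]
  rw [← hb, ← cut_σ_inl, ← h2, src_σ]
  exact (O.cut P).src_eq_src_iff.2 (Equiv.Perm.sameCycle_pow_right.2 (.refl _ _))

theorem IsFreeRegion.exists_isTwoCycle_cut {a b : D} {T : Set D} (hT : O.IsFreeRegion a b T)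
    {P : List D} {u w : O.Vertex} (hP : O.IsPath u P w)
    (hPT : ∀ d ∈ O.boundaryWalk P, d ∈ T → d ∈ O.edgePair a b) :
    (O.cut P).IsTwoCycle (.inl a) ((O.cut P).θ (.inl (O.θ b))) where
  src_eq := hT.src_cut_eq hPT
  tgt_eq := by
    rw [tgt_θ]
    have := hT.θ.src_cut_eq (P := P) (by rwa [edgePair_θ])
    rw [O.θ_θ] at this
    exact this.symm
  not_loop h := by
    have := hP.src_proj_eq (e := (O.cut P).θ (.inl a)) h
    rw [proj_θ] at this
    exact hT.not_loop this
  ne h := by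
    have := congrArg CutDart.proj h
    rw [proj_θ] at this
    exact hT.ne (this.trans (O.θ_θ b))

theorem IsCutPath.exists_isFreeRegion {P : List D} (hP : O.IsCutPath P) {a b : O.CutDart P}
    (h : (O.cut P).IsTwoCycle a b) : ∃ c d T, O.IsFreeRegion c d T := by
  have hne : P ≠ [] := by
    rintro rfl
    exact O.v_injective.ne (show (1 : Fin 3) ≠ 2 by decide) hP.1.1
  have hab : a.proj ≠ b.proj := by
    intro hab
    obtain ⟨i, h1, h2⟩ := O.exists_v_ne (O.src a.proj) (O.tgt a.proj)
    obtain ⟨d, hd, hi⟩ := hP.1.exists_mem_boundaryWalk hne (hP.v_mem i)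
    rcases hP.1.eq_or_eq_of_proj_eq h hab hd with rfl | rfl
    · exact h1 hi.symm
    · exact h2 hi.symm
  have hcyc : O.IsTwoCycle a.proj b.proj :=
    ⟨hP.1.src_proj_eq h.src_eq, hP.1.tgt_proj_eq h.tgt_eq,
      fun h => O.proper a.proj (congrArg _ h), hab⟩
  obtain ⟨T, hT, hTne, hfree⟩ := hP.1.exists_region O.isPlane h hcyc hne
  rcases LopspOperation.exists_isFreeRegion hcyc hT hTne (fun i d hd hi => by
    rw [← hi]; exact hfree d hd (hi ▸ hP.v_mem i)) with h | h
  · exact ⟨_, _, _, h⟩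
  · exact ⟨_, _, _, h⟩

theorem isC2_iff : O.IsC2 ↔ ∀ a b T, ¬ O.IsFreeRegion a b T := by
  constructor
  · intro h a b T hT
    obtain ⟨P, hP, hPT⟩ := exists_isMinCutPath_avoiding hT
    exact h P hP ⟨_, _, hT.exists_isTwoCycle_cut hP.1.1 hPT⟩
  · rintro h P hP ⟨a, b, hab⟩
    obtain ⟨c, d, T, hT⟩ := hP.1.exists_isFreeRegion hab
    exact h c d T hT

end LopspOperation

theorem mainTheorem2 {D : Type*} [Finite D] (O : LopspOperation D) :
    O.IsC2 ↔
      ∀ (a b : D) (h : O.predecoration.IsTwoCycle a b),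
        ∀ S : (CombMap.twoCycle h.toIsTwoCycle).Side,
          ∃ i : Fin 3, O.v i ∈ (CombMap.twoCycle h.toIsTwoCycle).interiorVerts S := by
  rw [LopspOperation.isC2_iff]
  constructor
  · intro H a b h
    exact (LopspOperation.forall_side_iff h.toIsTwoCycle).2 fun T => ⟨H a b T, H b a T⟩
  · intro H a b T hT
    obtain ⟨c, d, T', hT', hs, ht⟩ := LopspOperation.exists_isFreeRegion_colour_ne_one hT
    have h : O.predecoration.IsTwoCycle c d :=
      -- Edges of colour 1 suffice here; the extra edge of `Q(O)` at `v 1` plays no role, as the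
      -- other direction holds for every 2-cycle of `O`.
      ⟨hT'.toIsTwoCycle, .inl ⟨hs, ht⟩, .inl ⟨hT'.src_eq ▸ hs, hT'.tgt_eq ▸ ht⟩⟩
    exact ((LopspOperation.forall_side_iff h.toIsTwoCycle).1 (H c d h) T').1 hT'
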